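/- Let $\delta = 1-\frac{1+\log\log 2}{\log 2}$. For a finite list $\mathbf c=(c_1,\dots,c_k)$ of non-negative integers put $$\mathscr L(\mathbf c)=\{m_1+2m_2+\cdots+km_k : m_j\in\mathbb Z,\ 0\le m_j\le c_j \text{ for } j=1,\dots,k\}.$$ There are absolute constants $c, C>0$ such that the following holds for every integer $k\ge 1$. If $\mathbf X_k=(X_1,\dots,X_k)$, where $X_1,\dots,X_k$ are independent random variables and $X_j$ has the Poisson distribution with parameter $1/j$, then $|\mathscr L(\mathbf X_k)|$ is integrable and $$c\,k^{1-\delta}(1+\log k)^{-3/2}\ \le\ \mathbb E\,|\mathscr L(\mathbf X_k)|\ \le\ C\,k^{1-\delta}(1+\log k)^{-3/2}.$$ -/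

import Mathlib

open MeasureTheory ProbabilityTheory

namespace FixedSets

/-- The exponent `δ = 1 - (1 + log log 2) / log 2 ≈ 0.08607`. -/
noncomputable def delta : ℝ := 1 - (1 + Real.log (Real.log 2)) / Real.log 2

/-- For a list `c = (c₁, …, c_k)` of non-negative integers, the finite set
`{m₁ + 2 m₂ + ⋯ + k m_k : 0 ≤ m_j ≤ c_j for j = 1, …, k}`.
The index `j : Fin k` stands for the position `j + 1`, and `Finset.Iic c` is the set of all
`m : Fin k → ℕ` with `m j ≤ c j` for every `j`. -/
def sumSet {k : ℕ} (c : Fin k → ℕ) : Finset ℕ :=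
  (Finset.Iic c).image fun m => ∑ j : Fin k, ((j : ℕ) + 1) * m j

end FixedSets

/-! By independence, the expectation is `exp (-H_k)`, of order `1/k`, times the sum over `c` of the
Poisson weights `∏ (1/j)^(c_j) / c_j!` times `|L(c)|`. That sum has order `(2 e log 2)^J J^(-3/2)`
for `2^J` of order `k`; as `e log 2 = 2^(1-δ)`, this is the claim.

Upper bound. Group the integers above `1` into dyadic blocks. The block counts `b_i` are again
independent Poisson, with parameters at most `log 2`. For any cut `m`, each element in a block from
`m` on at most doubles the number of sums, while the earlier elements contribute at most `1` plus
their total (`card_sumSet_le`). Cut where the walk with steps `b_i - 1` is maximal. Mecke's formula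
reduces the second factor to `2^(m+1)` (`tsum_isMaxAt_le`), and the sum splits at `m` into a walk
ending near its maximum, with parameter `log 2 < 1`, and a walk staying nonpositive, with parameter
`2 log 2 > 1`. Comparison with the first-passage weights `hittingWeight` gives each part a power
`-3/2` of its length, and convolution over `m` preserves this power.

Lower bound. Keep only total count `J`, that is, `J`-tuples of integers, sorted by the blocks `g` of
their entries. Cauchy–Schwarz bounds the number of subset sums below by `4^J` over the number of
coincidences. A coincidence between different subsets determines an entry in the highest block where
they differ, so the average number of coincidences is controlled by `coincidenceSum g`. Over the `J`
cyclic rotations of `g` the reciprocals of this quantity add up to exactly `1/2`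
(`sum_inv_coincidenceSum_rotate`): this is a cycle lemma, and it yields a factor `1/J`. Stirling's
formula for `J^J / J!` supplies the remaining `J^(-1/2)`. -/

namespace FixedSets

open scoped ENNReal NNReal Nat
open Finset

/-! ### Poisson sums: marking a point, superposition, conditioning on the total -/

section PoissonWeights

variable {ι κ : Type*} [Fintype ι] [Fintype κ] [DecidableEq ι] [DecidableEq κ]

/-- The unnormalised Poisson weight `∏ xⱼ ^ cⱼ / cⱼ!`. -/
noncomputable def poissonWeight {ι : Type*} [Fintype ι] (x : ι → ℝ≥0∞) (c : ι → ℕ) : ℝ≥0∞ :=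
  ∏ j, x j ^ c j / ((c j)! : ℝ≥0∞)

theorem pow_div_factorial_succ (x : ℝ≥0∞) (n : ℕ) :
    ((n + 1 : ℕ) : ℝ≥0∞) * (x ^ (n + 1) / ((n + 1)! : ℝ≥0∞)) = x * (x ^ n / (n ! : ℝ≥0∞)) := by
  have h1 : ((n + 1 : ℕ) : ℝ≥0∞) ≠ 0 := by exact_mod_cast n.succ_ne_zero
  have h2 : ((n + 1 : ℕ) : ℝ≥0∞) ≠ ∞ := ENNReal.natCast_ne_top _
  rw [Nat.factorial_succ, Nat.cast_mul, div_eq_mul_inv, div_eq_mul_inv,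
    ENNReal.mul_inv (Or.inl h1) (Or.inl h2), pow_succ]
  calc _ = (((n + 1 : ℕ) : ℝ≥0∞) * ((n + 1 : ℕ) : ℝ≥0∞)⁻¹) * (x * (x ^ n * (n ! : ℝ≥0∞)⁻¹)) := by
        ring
    _ = _ := by rw [ENNReal.mul_inv_cancel h1 h2, one_mul]

theorem poissonWeight_add_single (x : ι → ℝ≥0∞) (c : ι → ℕ) (j : ι) :
    ((c j + 1 : ℕ) : ℝ≥0∞) * poissonWeight x (c + Pi.single j 1) = x j * poissonWeight x c := by
  unfold poissonWeight
  rw [Fintype.prod_eq_mul_prod_compl j, Fintype.prod_eq_mul_prod_compl j, ← mul_assoc, ← mul_assoc]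
  congr 1
  · simpa using pow_div_factorial_succ (x j) (c j)
  · refine prod_congr rfl fun i hi => ?_
    have : i ≠ j := by simpa using hi
    simp [Pi.single_eq_of_ne this]

/-- Mecke's formula for independent Poisson variables. -/
theorem tsum_mul_poissonWeight (x : ι → ℝ≥0∞) (j : ι) (G : (ι → ℕ) → ℝ≥0∞) :
    ∑' c, (c j : ℝ≥0∞) * (poissonWeight x c * G c) =
      x j * ∑' c, poissonWeight x c * G (c + Pi.single j 1) := by
  have hinj : Function.Injective fun c : ι → ℕ => c + Pi.single j 1 := add_left_injective _
  rw [← hinj.tsum_eq (f := fun c => (c j : ℝ≥0∞) * (poissonWeight x c * G c)),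
    ← ENNReal.tsum_mul_left]
  · refine tsum_congr fun c => ?_
    have := poissonWeight_add_single x c j
    simp only [Pi.add_apply, Pi.single_eq_same]
    rw [← mul_assoc, this, mul_assoc]
  · intro c hc
    have hcj : c j ≠ 0 := by
      rintro h
      simp [h] at hc
    refine ⟨c - Pi.single j 1, ?_⟩
    funext i
    rcases eq_or_ne i j with rfl | h
    · simp; omega
    · simp [Pi.single_eq_of_ne h]

/-- The part of a Poisson sum where the total count is `r`. -/
noncomputable def layerSum {ι : Type*} [Fintype ι] (x : ι → ℝ≥0∞) (r : ℕ)
    (G : (ι → ℕ) → ℝ≥0∞) : ℝ≥0∞ :=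
  ∑' c, poissonWeight x c * if ∑ j, c j = r then G c else 0

omit [DecidableEq ι] in
theorem tsum_layerSum (x : ι → ℝ≥0∞) (G : (ι → ℕ) → ℝ≥0∞) :
    ∑' r, layerSum x r G = ∑' c, poissonWeight x c * G c := by
  unfold layerSum
  rw [ENNReal.tsum_comm]
  refine tsum_congr fun c => ?_
  rw [ENNReal.tsum_mul_left, tsum_ite_eq' (∑ j, c j) (fun _ => G c)]

omit [DecidableEq ι] in
theorem layerSum_zero (x : ι → ℝ≥0∞) (G : (ι → ℕ) → ℝ≥0∞) : layerSum x 0 G = G 0 := by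
  unfold layerSum
  rw [tsum_eq_single 0]
  · simp [poissonWeight]
  · intro c hc
    have : ¬ (∑ j, c j = 0) := by
      intro h
      exact hc (funext fun j => by simpa using (sum_eq_zero_iff.mp h) j (mem_univ j))
    simp [this]

/-- On this layer `r + 1` is the sum of the `c j`, so Mecke's formula applies to each `j`. The
resulting recursion drives the inductions on the total count. -/
theorem layerSum_succ (x : ι → ℝ≥0∞) (r : ℕ) (G : (ι → ℕ) → ℝ≥0∞) :
    ((r + 1 : ℕ) : ℝ≥0∞) * layerSum x (r + 1) G =
      ∑ j, x j * layerSum x r fun c => G (c + Pi.single j 1) := by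
  have h1 : ((r + 1 : ℕ) : ℝ≥0∞) * layerSum x (r + 1) G =
      ∑' c : ι → ℕ, ∑ j, (c j : ℝ≥0∞) *
        (poissonWeight x c * if ∑ j, c j = r + 1 then G c else 0) := by
    unfold layerSum
    rw [← ENNReal.tsum_mul_left]
    refine tsum_congr fun c => ?_
    rw [← sum_mul]
    split_ifs with h
    · rw [← h]; push_cast; rfl
    · simp
  rw [h1, Summable.tsum_finsetSum fun _ _ => ENNReal.summable]
  refine sum_congr rfl fun j _ => ?_
  rw [tsum_mul_poissonWeight]
  simp [layerSum, sum_add_distrib]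

/-- The sums of `c` over the fibres of `f`. -/
def fiberSum {ι κ M : Type*} [Fintype ι] [DecidableEq κ] [AddCommMonoid M] (f : ι → κ)
    (c : ι → M) (i : κ) : M :=
  ∑ j with f j = i, c j

omit [Fintype κ] in
theorem fiberSum_add_single (f : ι → κ) (c : ι → ℕ) (j : ι) :
    fiberSum f (c + Pi.single j 1) = fiberSum f c + Pi.single (f j) 1 := by
  funext i
  simp only [fiberSum, Pi.add_apply, sum_add_distrib, add_right_inj]
  rcases eq_or_ne i (f j) with rfl | h
  · simp [Finset.sum_pi_single']
  · simp [Finset.sum_pi_single', h, h.symm]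

/-- Both sides obey the recursion `layerSum_succ`: on the left, the terms over one fibre of `f`
share the same shifted `G`, so their `x j` add up. -/
theorem layerSum_fiberSum (x : ι → ℝ≥0∞) (f : ι → κ) (r : ℕ) (G : (κ → ℕ) → ℝ≥0∞) :
    layerSum x r (fun c => G (fiberSum f c)) = layerSum (fiberSum f x) r G := by
  induction r generalizing G with
  | zero =>
    rw [layerSum_zero, layerSum_zero]
    congr 1
    funext i
    simp [fiberSum]
  | succ r ih =>
    have h1 : ((r + 1 : ℕ) : ℝ≥0∞) ≠ 0 := by exact_mod_cast r.succ_ne_zero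
    have h2 : ((r + 1 : ℕ) : ℝ≥0∞) ≠ ∞ := ENNReal.natCast_ne_top _
    rw [← ENNReal.mul_right_inj h1 h2, layerSum_succ, layerSum_succ]
    simp only [fiberSum_add_single]
    rw [← Finset.sum_fiberwise univ f]
    refine sum_congr rfl fun i _ => ?_
    conv_rhs => rw [fiberSum, sum_mul]
    refine sum_congr rfl fun j hj => ?_
    obtain rfl := (mem_filter.mp hj).2
    exact congrArg _ (ih fun b => G (b + Pi.single (f j) 1))

/-- Superposition: block sums of independent Poisson variables are independent Poisson. -/
theorem tsum_poissonWeight_fiberSum (x : ι → ℝ≥0∞) (f : ι → κ) (G : (κ → ℕ) → ℝ≥0∞) :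
    ∑' c, poissonWeight x c * G (fiberSum f c) = ∑' b, poissonWeight (fiberSum f x) b * G b := by
  rw [← tsum_layerSum x fun c => G (fiberSum f c), ← tsum_layerSum]
  exact tsum_congr fun r => layerSum_fiberSum x f r G

/-- The number of times each value is taken by the tuple `a`. -/
def tally {ι : Type*} [DecidableEq ι] {r : ℕ} (a : Fin r → ι) (j : ι) : ℕ := #{i | a i = j}

omit [Fintype ι] in
theorem tally_cons {r : ℕ} (j : ι) (a : Fin r → ι) :
    tally (Fin.cons j a : Fin (r + 1) → ι) = tally a + Pi.single j 1 := by
  funext i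
  simp only [tally, card_filter, Fin.sum_univ_succ, Fin.cons_zero, Fin.cons_succ, Pi.add_apply,
    Pi.single_apply]
  rw [add_comm]
  simp [eq_comm]

/-- Given their total `r`, Poisson counts are the tally of `r` independent draws; the recursion adds
one draw at a time. -/
theorem factorial_mul_layerSum (x : ι → ℝ≥0∞) (r : ℕ) (G : (ι → ℕ) → ℝ≥0∞) :
    (r ! : ℝ≥0∞) * layerSum x r G = ∑ a : Fin r → ι, (∏ i, x (a i)) * G (tally a) := by
  induction r generalizing G with
  | zero =>
    rw [layerSum_zero]
    simp only [Nat.factorial_zero, Nat.cast_one, one_mul, univ_unique, univ_eq_empty, prod_empty,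
      sum_singleton]
    congr 1
  | succ r ih =>
    rw [Nat.factorial_succ, mul_comm (r + 1), Nat.cast_mul, mul_assoc, layerSum_succ, mul_sum,
      ← (Fin.consEquiv fun _ : Fin (r + 1) => ι).sum_comp, Fintype.sum_prod_type]
    refine sum_congr rfl fun j _ => ?_
    rw [mul_left_comm, ih, mul_sum]
    refine sum_congr rfl fun a _ => ?_
    simp [Fin.consEquiv, tally_cons, Fin.prod_univ_succ, mul_assoc]

end PoissonWeights

/-! ### Splitting sums over tuples -/

theorem tsum_fin_cons {n : ℕ} (F : (Fin (n + 1) → ℕ) → ℝ≥0∞) :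
    ∑' c, F c = ∑' (t : ℕ) (c : Fin n → ℕ), F (Fin.cons t c) := by
  rw [← (Fin.consEquiv fun _ : Fin (n + 1) => ℕ).tsum_eq, ENNReal.tsum_prod']
  rfl

theorem tsum_fin_snoc {n : ℕ} (F : (Fin (n + 1) → ℕ) → ℝ≥0∞) :
    ∑' c, F c = ∑' (t : ℕ) (c : Fin n → ℕ), F (Fin.snoc c t) := by
  rw [← (Fin.snocEquiv fun _ : Fin (n + 1) => ℕ).tsum_eq, ENNReal.tsum_prod']
  rfl

theorem tsum_fin_append {m n : ℕ} (F : (Fin (m + n) → ℕ) → ℝ≥0∞) :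
    ∑' c, F c = ∑' (p : Fin m → ℕ) (q : Fin n → ℕ), F (Fin.append p q) := by
  rw [← (Fin.appendEquiv m n).tsum_eq, ENNReal.tsum_prod']
  rfl

theorem poissonWeight_cons {n : ℕ} (x : Fin (n + 1) → ℝ≥0∞) (t : ℕ) (c : Fin n → ℕ) :
    poissonWeight x (Fin.cons t c) =
      x 0 ^ t / (t ! : ℝ≥0∞) * poissonWeight (fun i => x i.succ) c := by
  simp [poissonWeight, Fin.prod_univ_succ]

theorem poissonWeight_snoc {n : ℕ} (x : ℝ≥0∞) (t : ℕ) (c : Fin n → ℕ) :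
    poissonWeight (fun _ => x) (Fin.snoc c t : Fin (n + 1) → ℕ) =
      x ^ t / (t ! : ℝ≥0∞) * poissonWeight (fun _ => x) c := by
  simp [poissonWeight, Fin.prod_univ_castSucc, mul_comm]

theorem poissonWeight_append {m n : ℕ} (x : ℝ≥0∞) (p : Fin m → ℕ) (q : Fin n → ℕ) :
    poissonWeight (fun _ => x) (Fin.append p q) =
      poissonWeight (fun _ => x) p * poissonWeight (fun _ => x) q := by
  simp [poissonWeight, Fin.prod_univ_add]

theorem poissonWeight_const {n : ℕ} (x : ℝ≥0∞) (c : Fin n → ℕ) :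
    poissonWeight (fun _ => x) c = x ^ (∑ i, c i) * poissonWeight (fun _ => 1) c := by
  simp [poissonWeight, div_eq_mul_inv, prod_mul_distrib, prod_pow_eq_pow_sum]

theorem poissonWeight_mono {ι : Type*} [Fintype ι] {x y : ι → ℝ≥0∞} (h : ∀ i, x i ≤ y i)
    (c : ι → ℕ) : poissonWeight x c ≤ poissonWeight y c :=
  prod_le_prod' fun i _ => ENNReal.div_le_div_right (pow_le_pow_left' (h i) _) _

/-! ### First-passage weights of the walk -/

theorem sum_range_mul_choose_mul_pow (y : ℝ) (N : ℕ) :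
    ∑ t ∈ range (N + 1), (t : ℝ) * (N.choose t * y ^ (N - t)) = N * (1 + y) ^ (N - 1) := by
  rcases N with _ | M
  · simp
  · rw [sum_range_succ']
    simp only [Nat.cast_zero, zero_mul, add_zero, Nat.add_sub_cancel, Nat.add_sub_add_right]
    rw [add_pow, mul_sum]
    refine sum_congr rfl fun t _ => ?_
    have h : ((M + 1 : ℕ) : ℝ) * (M.choose t : ℝ) = ((M + 1).choose (t + 1) : ℝ) * (t + 1 : ℕ) := by
      exact_mod_cast Nat.add_one_mul_choose_eq M t
    rw [one_pow, one_mul]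
    linear_combination -(y ^ (M - t)) * h

/-- The total weight `∏ 1 / bᵢ!` of the tuples `b` of length `n` whose walk with steps `bᵢ - 1`
first reaches `-h` at time `n`. -/
noncomputable def hittingWeight (n h : ℕ) : ℝ :=
  if h ≤ n then h / n * ((n : ℝ) ^ (n - h) / (n - h)!) else 0

theorem hittingWeight_nonneg (n h : ℕ) : 0 ≤ hittingWeight n h := by
  unfold hittingWeight
  split_ifs <;> positivity

/-- First-step decomposition: with `q + 1` to descend, a step `t - 1` leaves `q + t`. For the closed
form this is the binomial theorem. The case `n = 0` fails at `q = 0`, since `hittingWeight 0 0 = 0`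
by division by zero. -/
theorem hittingWeight_succ {n q : ℕ} (hn : n ≠ 0) (hq : q ≤ n) :
    hittingWeight (n + 1) (q + 1) =
      ∑ t ∈ range (n - q + 1), 1 / (t ! : ℝ) * hittingWeight n (q + t) := by
  obtain ⟨N, rfl⟩ := Nat.exists_eq_add_of_le hq
  have hpos : (0 : ℝ) < ((q + N : ℕ) : ℝ) := by exact_mod_cast Nat.pos_of_ne_zero hn
  have hfac : (0 : ℝ) < (N ! : ℝ) := by positivity
  set n : ℕ := q + N with hndef
  have hterm : ∀ t ∈ range (n - q + 1), 1 / (t ! : ℝ) * hittingWeight n (q + t) =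
      1 / ((n : ℝ) * N !) * (q * (1 ^ t * (n : ℝ) ^ (N - t) * N.choose t) +
        t * (N.choose t * (n : ℝ) ^ (N - t))) := by
    intro t ht
    have htN : t ≤ N := by
      have := mem_range.mp ht
      omega
    rw [hittingWeight, if_pos (by omega), show n - (q + t) = N - t by omega]
    have hch : (N.choose t : ℝ) = N ! / (t ! * (N - t)!) := Nat.cast_choose ℝ htN
    rw [hch]
    have h1 : (0 : ℝ) < (t ! : ℝ) := by positivity
    have h2 : (0 : ℝ) < ((N - t)! : ℝ) := by positivity
    push_cast
    field_simp
    ring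
  rw [sum_congr rfl hterm, ← mul_sum, sum_add_distrib, ← mul_sum,
    show n - q + 1 = N + 1 by omega, sum_range_mul_choose_mul_pow, ← add_pow,
    hittingWeight, if_pos (by omega), show n + 1 - (q + 1) = N by omega]
  have hqr : (q : ℝ) = n - N := by rw [hndef]; push_cast; ring
  have hn1 : (0 : ℝ) < (n : ℝ) + 1 := by positivity
  rw [add_comm (1 : ℝ) (n : ℝ)]
  push_cast
  rw [hqr]
  rcases N with _ | M
  · simp only [pow_zero]
    field_simp
    push_cast
    ring
  · simp only [Nat.add_sub_cancel, pow_succ]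
    push_cast
    field_simp
    ring

/-- The extended nonnegative real version of `hittingWeight`. -/
noncomputable def hittingMass (n h : ℕ) : ℝ≥0∞ := ENNReal.ofReal (hittingWeight n h)

theorem tsum_hittingMass {n : ℕ} (hn : n ≠ 0) (q : ℕ) :
    ∑' t, 1 / (t ! : ℝ≥0∞) * hittingMass n (q + t) = hittingMass (n + 1) (q + 1) := by
  rcases le_or_gt q n with hq | hq
  · rw [tsum_eq_sum (s := range (n - q + 1)), hittingMass, hittingWeight_succ hn hq,
      ENNReal.ofReal_sum_of_nonneg]
    · refine sum_congr rfl fun t _ => ?_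
      rw [hittingMass, ENNReal.ofReal_mul (by positivity), ENNReal.ofReal_div_of_pos (by positivity)]
      simp
    · intro t _
      have := hittingWeight_nonneg n (q + t)
      positivity
    · intro t ht
      have : n - q + 1 ≤ t := by simpa using ht
      rw [hittingMass, hittingWeight, if_neg (by omega)]
      simp
  · rw [hittingMass, hittingWeight, if_neg (by omega)]
    simp only [ENNReal.ofReal_zero, ENNReal.tsum_eq_zero]
    intro t
    rw [hittingMass, hittingWeight, if_neg (by omega)]
    simp

/-- Since `n! ≤ (n - h)! n^h`, the weight is at most `(h / n) n^n / n!`; Stirling's `n^(-1/2)` and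
the `1 / n` make the exponent `-3/2`. -/
theorem hittingWeight_le {n : ℕ} (hn : n ≠ 0) (h : ℕ) :
    hittingWeight n h ≤ h * Real.exp n * (n : ℝ) ^ (-(3 / 2) : ℝ) := by
  have hn0 : (0 : ℝ) < n := by exact_mod_cast Nat.pos_of_ne_zero hn
  unfold hittingWeight
  split_ifs with hle
  swap
  · positivity
  have h1 : (n : ℝ) ^ (n - h) / (n - h)! ≤ (n : ℝ) ^ n / n ! := by
    rw [div_le_div_iff₀ (by positivity) (by positivity)]
    have h2 : (n ! : ℝ) ≤ (n - h)! * (n : ℝ) ^ h := by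
      have h3 := Nat.factorial_mul_descFactorial hle
      have h4 := Nat.descFactorial_le_pow n h
      rw [← h3]
      push_cast
      gcongr
      exact_mod_cast h4
    calc (n : ℝ) ^ (n - h) * n ! ≤ (n : ℝ) ^ (n - h) * ((n - h)! * (n : ℝ) ^ h) := by gcongr
      _ = (n : ℝ) ^ (n - h + h) * (n - h)! := by rw [pow_add]; ring
      _ = _ := by rw [Nat.sub_add_cancel hle]
  have h5 : (n : ℝ) ^ n / n ! ≤ Real.exp n * (n : ℝ) ^ (-(1 / 2) : ℝ) := by
    have h6 := Stirling.le_factorial_stirling n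
    have h7 : √(n : ℝ) ≤ √(2 * Real.pi * n) := by
      apply Real.sqrt_le_sqrt
      have := Real.pi_gt_three
      nlinarith
    rw [Real.rpow_neg hn0.le, ← Real.sqrt_eq_rpow, div_le_iff₀ (by positivity)]
    have h8 : √(n : ℝ) * ((n : ℝ) / Real.exp 1) ^ n ≤ n ! := le_trans (by gcongr) h6
    have h9 : (0 : ℝ) < √n := Real.sqrt_pos.mpr hn0
    rw [div_pow, ← Real.exp_nat_mul, mul_one] at h8
    calc (n : ℝ) ^ n = Real.exp n * (√n)⁻¹ * (√n * ((n : ℝ) ^ n / Real.exp n)) := by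
          field_simp
      _ ≤ _ := by gcongr
  calc (h : ℝ) / n * ((n : ℝ) ^ (n - h) / (n - h)!)
      ≤ (h : ℝ) / n * (Real.exp n * (n : ℝ) ^ (-(1 / 2) : ℝ)) := by
        gcongr
        exact h1.trans h5
    _ = h * Real.exp n * ((n : ℝ) ^ (-(1 / 2) : ℝ) * (n : ℝ) ^ (-1 : ℝ)) := by
        rw [Real.rpow_neg_one]; field_simp
    _ = _ := by rw [← Real.rpow_add hn0]; norm_num

theorem factorial_le_stirling {n : ℕ} (hn : n ≠ 0) :
    (n ! : ℝ) ≤ Real.exp 1 * √n * ((n : ℝ) / Real.exp 1) ^ n := by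
  obtain ⟨m, rfl⟩ := Nat.exists_eq_succ_of_ne_zero hn
  have h := Stirling.stirlingSeq'_antitone (Nat.zero_le m)
  simp only [Function.comp, Nat.succ_eq_add_one, zero_add, Stirling.stirlingSeq_one] at h
  rw [Stirling.stirlingSeq, div_le_iff₀ (by positivity)] at h
  refine h.trans_eq ?_
  rw [Real.sqrt_mul (by norm_num)]
  field_simp

/-- The weight here is half of `(2N)^N / N!`. The bound lets a decaying factor `x ^ N` be traded for
a first-passage weight. -/
theorem le_hittingWeight {N : ℕ} (hN : N ≠ 0) :
    (2 * Real.exp 1) ^ N ≤ 2 * Real.exp 1 * √N * hittingWeight (2 * N) N := by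
  have hN0 : (0 : ℝ) < N := by exact_mod_cast Nat.pos_of_ne_zero hN
  rw [hittingWeight, if_pos (by omega), show 2 * N - N = N by omega]
  have h := factorial_le_stirling hN
  have hf : (0 : ℝ) < (N ! : ℝ) := by positivity
  push_cast
  calc (2 * Real.exp 1) ^ N = (2 * Real.exp 1) ^ N * N ! / N ! := by field_simp
    _ ≤ (2 * Real.exp 1) ^ N * (Real.exp 1 * √N * ((N : ℝ) / Real.exp 1) ^ N) / N ! := by gcongr
    _ = _ := by
      rw [mul_pow, div_pow, mul_pow]
      field_simp

/-! ### Walks on the two sides of the maximum -/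

/-- The walk with steps `qᵢ - 1` never exceeds `0`. -/
def StaysNonpos {n : ℕ} (q : Fin n → ℕ) : Prop := ∀ j ≤ n, ∑ i : Fin n with i.val < j, q i ≤ j

/-- No position of the walk with steps `pᵢ - 1` exceeds its last position by more than one. -/
def EndsNearMax {m : ℕ} (p : Fin m → ℕ) : Prop := ∀ j ≤ m, m ≤ j + 1 + ∑ i : Fin m with j ≤ i.val, p i

open Classical in
-- Read backwards, `p` avoids `-2` up to time `m`; a descent by `∑ p + 2 - m` in `n` further steps
-- completes it to a first passage to `-2` at time `m + n`. The first entry of `p` is adjacent to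
-- that descent, so the induction moves it there.
theorem tsum_endsNearMax_le (m : ℕ) {n : ℕ} (hn : n ≠ 0) :
    ∑' p : Fin m → ℕ, poissonWeight (fun _ => 1) p *
      (if EndsNearMax p then hittingMass n (∑ i, p i + 2 - m) else 0) ≤ hittingMass (m + n) 2 := by
  induction m generalizing n with
  | zero =>
    rw [tsum_eq_single default fun p hp => absurd (Subsingleton.elim _ _) hp]
    simp only [poissonWeight, univ_eq_empty, prod_empty, sum_empty, one_mul, zero_add,
      Nat.sub_zero]
    split_ifs <;> simp
  | succ m ih =>
    rw [tsum_fin_cons, ENNReal.tsum_comm]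
    refine le_trans (ENNReal.tsum_le_tsum fun p => ?_)
      ((ih (n := n + 1) n.succ_ne_zero).trans_eq (by rw [add_right_comm, add_assoc]))
    by_cases hp : EndsNearMax p
    · have hq : m ≤ 1 + ∑ i, p i := by simpa using hp 0 (Nat.zero_le m)
      rw [if_pos hp, show ∑ i, p i + 2 - m = (∑ i, p i + 1 - m) + 1 by omega,
        ← tsum_hittingMass hn, ← ENNReal.tsum_mul_left]
      refine ENNReal.tsum_le_tsum fun t => ?_
      rw [poissonWeight_cons, one_pow, mul_comm (1 / (t ! : ℝ≥0∞)), mul_assoc]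
      gcongr
      split_ifs
      · rw [Fin.sum_univ_succ]
        simp only [Fin.cons_zero, Fin.cons_succ]
        rw [show t + ∑ i, p i + 2 - (m + 1) = ∑ i, p i + 1 - m + t by omega]
      · exact zero_le
    · rw [if_neg hp, mul_zero, nonpos_iff_eq_zero, ENNReal.tsum_eq_zero]
      intro t
      rw [if_neg, mul_zero]
      intro hc
      refine hp fun j hj => ?_
      have h := hc (j + 1) (by omega)
      simp only [sum_filter, Fin.sum_univ_succ, Fin.val_zero, Nat.le_zero, Fin.val_succ,
        Nat.add_le_add_iff_right, Fin.cons_succ, Nat.add_eq_zero_iff, one_ne_zero, and_false,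
        if_false, zero_add] at h
      rw [sum_filter]
      omega

open Classical in
-- Read backwards and followed by one step `-1`, such a walk first reaches `-u` at time `n + 1`.
theorem tsum_staysNonpos_le (n u : ℕ) :
    ∑' q : Fin n → ℕ, poissonWeight (fun _ => 1) q *
      (if StaysNonpos q ∧ ∑ i, q i + u = n + 1 then 1 else 0) ≤ hittingMass (n + 1) u := by
  induction n generalizing u with
  | zero =>
    rw [tsum_eq_single default fun p hp => absurd (Subsingleton.elim _ _) hp]
    simp only [poissonWeight, univ_eq_empty, prod_empty, sum_empty, one_mul, zero_add]
    split_ifs with h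
    · rw [h.2]
      simp [hittingMass, hittingWeight]
    · exact zero_le
  | succ n ih =>
    rcases u with _ | s
    · refine le_of_eq_of_le (ENNReal.tsum_eq_zero.mpr fun q => ?_) (zero_le)
      rw [if_neg, mul_zero]
      rintro ⟨h1, h2⟩
      have := h1 (n + 1) le_rfl
      rw [filter_true_of_mem fun i _ => i.isLt] at this
      omega
    · rw [tsum_fin_snoc, ← tsum_hittingMass n.succ_ne_zero]
      refine ENNReal.tsum_le_tsum fun t => ?_
      refine le_trans ?_ (mul_le_mul_right (ih (s + t)) _)
      rw [← ENNReal.tsum_mul_left]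
      refine ENNReal.tsum_le_tsum fun q => ?_
      rw [poissonWeight_snoc, one_pow, mul_assoc]
      gcongr
      split_ifs with h1 h2
      · exact le_rfl
      · refine absurd ⟨fun j hj => ?_, ?_⟩ h2
        · have h := h1.1 j (by omega)
          simp only [sum_filter, Fin.sum_univ_castSucc, Fin.snoc_castSucc, Fin.val_castSucc,
            Fin.val_last, Fin.snoc_last, if_neg (show ¬ n < j by omega), add_zero] at h
          rwa [sum_filter]
        · have h := h1.2
          simp only [Fin.sum_univ_castSucc, Fin.snoc_castSucc, Fin.snoc_last] at h
          omega
      · exact zero_le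
      · exact le_rfl

theorem summable_nat_mul_pow {r : ℝ} (h0 : 0 ≤ r) (h1 : r < 1) :
    Summable fun n : ℕ => (n : ℝ) * r ^ n := by
  simpa using summable_pow_mul_geometric_of_norm_lt_one 1 (r := r)
    (by rwa [Real.norm_of_nonneg h0])

theorem hittingMass_le {n : ℕ} (hn : n ≠ 0) (h : ℕ) :
    hittingMass n h ≤ ENNReal.ofReal (h * Real.exp n * (n : ℝ) ^ (-(3 / 2) : ℝ)) :=
  ENNReal.ofReal_le_ofReal (hittingWeight_le hn h)

open Classical in
-- Group by the endpoint `1 - u`. Changing the parameter from `1` to `ρ = 2 log 2` costs `ρ ^ (n + 1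
-- - u)`, and `∑ u ρ⁻ᵘ` converges because `ρ > 1`.
theorem exists_tsum_staysNonpos_le : ∃ C : ℝ, 0 < C ∧ ∀ n : ℕ,
    ∑' q : Fin n → ℕ, poissonWeight (fun _ => ENNReal.ofReal (2 * Real.log 2)) q *
      (if StaysNonpos q then 1 else 0) ≤
    ENNReal.ofReal
      (C * ((2 * Real.exp 1 * Real.log 2) ^ n * ((n : ℝ) + 1) ^ (-(3 / 2) : ℝ))) := by
  set ρ : ℝ := 2 * Real.log 2 with hρ
  have hρ1 : 1 < ρ := by have := Real.log_two_gt_d9; linarith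
  have hρ0 : 0 < ρ := by linarith
  have hsum : Summable fun u : ℕ => (u : ℝ) * ρ⁻¹ ^ u :=
    summable_nat_mul_pow (by positivity) (inv_lt_one_of_one_lt₀ hρ1)
  set S := ∑' u : ℕ, (u : ℝ) * ρ⁻¹ ^ u with hS
  have hSpos : 0 < S := hsum.tsum_pos (fun u => by positivity) 1 (by simp; positivity)
  refine ⟨ρ * Real.exp 1 * S, by positivity, fun n => ?_⟩
  set A : ℕ → ℝ≥0∞ := fun u => ∑' q : Fin n → ℕ, poissonWeight (fun _ => 1) q *
      (if StaysNonpos q ∧ ∑ i, q i + u = n + 1 then 1 else 0) with hA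
  have key : ∑' q : Fin n → ℕ, poissonWeight (fun _ => ENNReal.ofReal ρ) q *
      (if StaysNonpos q then 1 else 0) ≤
      ∑ u ∈ range (n + 2), ENNReal.ofReal ρ ^ (n + 1 - u) * A u := by
    simp only [hA, ← ENNReal.tsum_mul_left]
    rw [← Summable.tsum_finsetSum fun _ _ => ENNReal.summable]
    refine ENNReal.tsum_le_tsum fun q => ?_
    split_ifs with hq
    swap
    · simp
    have hle : ∑ i, q i ≤ n := by
      have := hq n le_rfl
      rwa [filter_true_of_mem fun i _ => i.isLt] at this
    refine le_trans ?_ (single_le_sum (f := fun u => ENNReal.ofReal ρ ^ (n + 1 - u) *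
      (poissonWeight (fun _ => 1) q *
        (if StaysNonpos q ∧ ∑ i, q i + u = n + 1 then 1 else 0)))
      (fun _ _ => zero_le) (mem_range.mpr (show n + 1 - ∑ i, q i < n + 2 by omega)))
    rw [if_pos ⟨hq, by omega⟩, poissonWeight_const,
      show n + 1 - (n + 1 - ∑ i, q i) = ∑ i, q i by omega, mul_assoc]
  refine key.trans ?_
  have hterm : ∀ u ∈ range (n + 2), ENNReal.ofReal ρ ^ (n + 1 - u) * A u ≤
      ENNReal.ofReal (ρ ^ (n + 1) * Real.exp (n + 1 : ℕ) *
        ((n + 1 : ℕ) : ℝ) ^ (-(3 / 2) : ℝ) * (u * ρ⁻¹ ^ u)) := by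
    intro u hu
    have hun : u ≤ n + 1 := by have := mem_range.mp hu; omega
    refine (mul_le_mul_right ((tsum_staysNonpos_le n u).trans
      (hittingMass_le n.succ_ne_zero u)) _).trans_eq ?_
    rw [← ENNReal.ofReal_pow hρ0.le, ← ENNReal.ofReal_mul (by positivity)]
    congr 1
    rw [inv_pow, pow_sub₀ _ hρ0.ne' hun]
    ring
  refine (sum_le_sum hterm).trans ?_
  rw [← ENNReal.ofReal_sum_of_nonneg fun u _ => by positivity, ← mul_sum]
  refine ENNReal.ofReal_le_ofReal ?_
  have h1 : ∑ u ∈ range (n + 2), (u : ℝ) * ρ⁻¹ ^ u ≤ S :=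
    hsum.sum_le_tsum _ fun u _ => by positivity
  have h2 : Real.exp ((n + 1 : ℕ) : ℝ) = Real.exp 1 ^ (n + 1) := by
    rw [← Real.exp_nat_mul, mul_one]
  calc _ ≤ ρ ^ (n + 1) * Real.exp (n + 1 : ℕ) * ((n + 1 : ℕ) : ℝ) ^ (-(3 / 2) : ℝ) * S := by
        gcongr
    _ = _ := by
        rw [h2, show 2 * Real.exp 1 * Real.log 2 = ρ * Real.exp 1 by rw [hρ]; ring, mul_pow]
        push_cast
        ring

open Classical in
-- The parameter `x = log 2` gives decay `x ^ h` in the height `h`. Trading it for the weight of a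
-- descent by `h` in `2h` steps completes every path to a first passage to `-2`; the remaining
-- series has ratio `x e / 2 < 1`.
theorem exists_tsum_endsNearMax_le : ∃ C : ℝ, 0 < C ∧ ∀ m : ℕ,
    ∑' p : Fin m → ℕ, poissonWeight (fun _ => ENNReal.ofReal (Real.log 2)) p *
      (if EndsNearMax p then 1 else 0) ≤
    ENNReal.ofReal (C * ((Real.exp 1 * Real.log 2) ^ m * ((m : ℝ) + 1) ^ (-(3 / 2) : ℝ))) := by
  set x : ℝ := Real.log 2 with hx
  have hx0 : 0 < x := Real.log_pos one_lt_two
  have hx1 : x * Real.exp 1 / 2 < 1 := by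
    have h1 := Real.log_two_lt_d9
    have h2 := Real.exp_one_lt_d9
    have h3 := Real.exp_pos 1
    nlinarith
  have hsum := summable_nat_mul_pow (r := x * Real.exp 1 / 2) (by positivity) hx1
  set S := ∑' N : ℕ, (N : ℝ) * (x * Real.exp 1 / 2) ^ N with hS
  have hSpos : 0 < S := hsum.tsum_pos (fun u => by positivity) 1 (by simp; positivity)
  set w : ℕ → ℝ := fun N => x ^ N * (2 * Real.exp 1 * √N / (2 * Real.exp 1) ^ N) with hw
  have hw0 : ∀ N, 0 ≤ w N := fun N => by positivity
  have hwle : ∀ h : ℕ, h ≠ 0 → x ^ h ≤ w h * hittingWeight (2 * h) h := by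
    intro h hh
    have := le_hittingWeight hh
    calc x ^ h = x ^ h * (2 * Real.exp 1) ^ h / (2 * Real.exp 1) ^ h := by field_simp
      _ ≤ x ^ h * (2 * Real.exp 1 * √h * hittingWeight (2 * h) h) / (2 * Real.exp 1) ^ h := by
        gcongr
      _ = _ := by simp only [hw]; ring
  refine ⟨4 * Real.exp 1 * S * (x ^ 2)⁻¹, by positivity, fun m => ?_⟩
  set H : ℕ → ℝ≥0∞ := fun n => ∑' p : Fin m → ℕ, poissonWeight (fun _ => 1) p *
      (if EndsNearMax p then hittingMass n (∑ i, p i + 2 - m) else 0) with hH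
  have key : ENNReal.ofReal (x ^ 2) * ∑' p : Fin m → ℕ,
      poissonWeight (fun _ => ENNReal.ofReal x) p * (if EndsNearMax p then 1 else 0) ≤
      ∑' N, ENNReal.ofReal (x ^ m * w N) * H (2 * N) := by
    simp only [hH, ← ENNReal.tsum_mul_left]
    rw [ENNReal.tsum_comm]
    refine ENNReal.tsum_le_tsum fun p => ?_
    split_ifs with hp
    swap
    · simp
    have hle : m ≤ 1 + ∑ i, p i := by simpa using hp 0 (Nat.zero_le m)
    set h := ∑ i, p i + 2 - m with hh
    refine le_trans ?_ (ENNReal.le_tsum h)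
    rw [poissonWeight_const, mul_one, ← mul_assoc, mul_comm (poissonWeight _ p), ← mul_assoc,
      ← ENNReal.ofReal_pow hx0.le, ← ENNReal.ofReal_mul (by positivity), hittingMass,
      ← ENNReal.ofReal_mul (by have := hw0 h; positivity)]
    refine mul_le_mul_left (ENNReal.ofReal_le_ofReal ?_) _
    rw [← pow_add, show 2 + ∑ i, p i = m + h by omega, pow_add, mul_assoc]
    gcongr
    exact hwle h (by omega)
  have hterm : ∀ N, ENNReal.ofReal (x ^ m * w N) * H (2 * N) ≤
      ENNReal.ofReal (4 * Real.exp 1 * ((Real.exp 1 * x) ^ m * ((m : ℝ) + 1) ^ (-(3 / 2) : ℝ)) *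
        (N * (x * Real.exp 1 / 2) ^ N)) := by
    intro N
    rcases Nat.eq_zero_or_pos N with rfl | hN
    · simp [hw]
    have h1 : H (2 * N) ≤ ENNReal.ofReal (2 * Real.exp (m + 2 * N : ℕ) *
        ((m : ℝ) + 1) ^ (-(3 / 2) : ℝ)) := by
      refine (tsum_endsNearMax_le m (by omega)).trans ((hittingMass_le (by omega) 2).trans ?_)
      refine ENNReal.ofReal_le_ofReal ?_
      push_cast
      refine mul_le_mul_of_nonneg_left ?_ (by positivity)
      refine Real.rpow_le_rpow_of_nonpos (by positivity) ?_ (by norm_num)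
      have : (1 : ℝ) ≤ N := by exact_mod_cast hN
      linarith
    refine (mul_le_mul_right h1 _).trans ?_
    rw [← ENNReal.ofReal_mul (by have := hw0 N; positivity)]
    refine ENNReal.ofReal_le_ofReal ?_
    have h2 : Real.exp ((m + 2 * N : ℕ) : ℝ) = Real.exp 1 ^ m * (Real.exp 1 ^ N) ^ 2 := by
      rw [← pow_mul, ← pow_add, ← Real.exp_nat_mul, mul_one, mul_comm N 2]
    have h3 : √(N : ℝ) ≤ N := by
      rw [Real.sqrt_le_left (by positivity)]
      have : (1 : ℝ) ≤ N := by exact_mod_cast hN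
      nlinarith
    rw [h2]
    calc _ = 4 * Real.exp 1 * ((Real.exp 1 * x) ^ m * ((m : ℝ) + 1) ^ (-(3 / 2) : ℝ)) *
        (√N * (x * Real.exp 1 / 2) ^ N) := by
          simp only [hw, mul_pow, div_pow]
          field_simp
          ring
      _ ≤ _ := by gcongr
  have htot : ∑' N, ENNReal.ofReal (x ^ m * w N) * H (2 * N) ≤
      ENNReal.ofReal (4 * Real.exp 1 * ((Real.exp 1 * x) ^ m * ((m : ℝ) + 1) ^ (-(3 / 2) : ℝ)) *
        S) := by
    refine (ENNReal.tsum_le_tsum hterm).trans_eq ?_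
    rw [← ENNReal.ofReal_tsum_of_nonneg (fun N => by positivity) (hsum.mul_left _), tsum_mul_left]
  have hx2 : ∀ z : ℝ≥0∞, z = ENNReal.ofReal (x ^ 2)⁻¹ * (ENNReal.ofReal (x ^ 2) * z) := by
    intro z
    rw [← mul_assoc, ← ENNReal.ofReal_mul (by positivity), inv_mul_cancel₀ (by positivity),
      ENNReal.ofReal_one, one_mul]
  refine (hx2 _).trans_le ?_
  refine (mul_le_mul_right (key.trans htot) _).trans_eq ?_
  rw [← ENNReal.ofReal_mul (by positivity)]
  congr 1
  ring

/-- The self-convolution of `(m + 1) ^ (-3/2)` is of the same order. -/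
theorem exists_convolution_le : ∃ C : ℝ, 0 < C ∧ ∀ J : ℕ,
    ∑ m ∈ range (J + 1), ((m : ℝ) + 1) ^ (-(3 / 2) : ℝ) * (((J - m : ℕ) : ℝ) + 1) ^ (-(3 / 2) : ℝ) ≤
      C * ((J : ℝ) + 1) ^ (-(3 / 2) : ℝ) := by
  set s : ℕ → ℝ := fun m => ((m : ℝ) + 1) ^ (-(3 / 2) : ℝ) with hs
  have hspos : ∀ m, 0 < s m := fun m => by positivity
  have hsum : Summable s := by
    have := (summable_nat_add_iff 1).mpr (Real.summable_nat_rpow (p := -(3 / 2)).mpr (by norm_num))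
    simpa [hs] using this
  have hanti : ∀ {m n : ℕ}, m ≤ n → s n ≤ s m := fun {m n} h =>
    Real.rpow_le_rpow_of_nonpos (by positivity) (by gcongr) (by norm_num)
  refine ⟨(1 / 2) ^ (-(3 / 2) : ℝ) * (2 * ∑' m, s m), ?_, fun J => ?_⟩
  · have := hsum.tsum_pos (fun m => (hspos m).le) 0 (hspos 0)
    positivity
  have hhalf : ∀ n : ℕ, J ≤ 2 * n → s n ≤ (1 / 2) ^ (-(3 / 2) : ℝ) * s J := by
    intro n hn
    rw [hs, ← Real.mul_rpow (by norm_num) (by positivity)]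
    refine Real.rpow_le_rpow_of_nonpos (by positivity) ?_ (by norm_num)
    have : (J : ℝ) ≤ 2 * n := by exact_mod_cast hn
    linarith
  have hterm : ∀ m ∈ range (J + 1), s m * s (J - m) ≤
      (1 / 2) ^ (-(3 / 2) : ℝ) * s J * (s m + s (J - m)) := by
    intro m hm
    have hmJ : m ≤ J := by have := mem_range.mp hm; omega
    have p1 := hspos m
    have p2 := hspos (J - m)
    -- One of `m` and `J - m` is at least `J / 2`, and its factor is then comparable to `s J`.
    rcases le_total J (2 * m) with h | h
    · have := mul_le_mul_of_nonneg_right (hhalf m h) p2.le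
      have p3 := (p1.trans_le (hhalf m h)).le
      nlinarith
    · have := mul_le_mul_of_nonneg_left (hhalf (J - m) (by omega)) p1.le
      have p3 := (p2.trans_le (hhalf (J - m) (by omega))).le
      nlinarith
  refine (sum_le_sum hterm).trans ?_
  rw [← mul_sum, sum_add_distrib]
  have h1 : ∑ m ∈ range (J + 1), s m ≤ ∑' m, s m := hsum.sum_le_tsum _ fun m _ => (hspos m).le
  have h2 : ∑ m ∈ range (J + 1), s (J - m) = ∑ m ∈ range (J + 1), s m := by
    simpa using sum_range_reflect s (J + 1)
  have h3 := hspos J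
  rw [h2]
  calc _ ≤ (1 / 2) ^ (-(3 / 2) : ℝ) * s J * (∑' m, s m + ∑' m, s m) := by gcongr
    _ = _ := by ring

/-! ### Cutting at the maximum of the block walk -/

theorem card_sumSet_le_prod {k : ℕ} (c : Fin k → ℕ) : #(sumSet c) ≤ 2 ^ ∑ j, c j := by
  refine card_image_le.trans ?_
  rw [Pi.card_Iic, ← prod_pow_eq_pow_sum]
  refine prod_le_prod' fun j _ => ?_
  rw [Nat.card_Iic]
  exact Nat.lt_two_pow_self

open Classical in
-- Every element is a sum over `s`, for which there are at most `2 ^ ∑ c j` values, plus a sum over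
-- the complement, which lies between `0` and the total there.
theorem card_sumSet_le {k : ℕ} (c : Fin k → ℕ) (s : Finset (Fin k)) :
    #(sumSet c) ≤ 2 ^ (∑ j ∈ s, c j) * (1 + ∑ j ∈ sᶜ, ((j : ℕ) + 1) * c j) := by
  have hsub : sumSet c ⊆ image₂ (· + ·) (sumSet fun j => if j ∈ s then c j else 0)
      (range (1 + ∑ j ∈ sᶜ, ((j : ℕ) + 1) * c j)) := by
    intro v hv
    obtain ⟨m, hm, rfl⟩ := mem_image.mp hv
    rw [mem_Iic] at hm
    rw [mem_image₂]
    refine ⟨_, mem_image.mpr ⟨fun j => if j ∈ s then m j else 0, ?_, rfl⟩,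
      ∑ j ∈ sᶜ, ((j : ℕ) + 1) * m j, ?_, ?_⟩
    · rw [mem_Iic]
      intro j
      dsimp only
      split_ifs
      · exact hm j
      · exact le_rfl
    · rw [mem_range, add_comm, Nat.lt_succ_iff]
      exact sum_le_sum fun j _ => Nat.mul_le_mul_left _ (hm j)
    · simp only [mul_ite, mul_zero, sum_ite_mem, univ_inter]
      exact sum_add_sum_compl s _
  refine (card_le_card hsub).trans (card_image₂_le _ _ _ |>.trans ?_)
  rw [card_range]
  refine Nat.mul_le_mul_right _ ((card_sumSet_le_prod _).trans_eq ?_)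
  simp

/-- The number of elements in the first `j` blocks. -/
def prefixSum {J : ℕ} (b : Fin J → ℕ) (j : ℕ) : ℕ := ∑ i : Fin J with i.val < j, b i

theorem prefixSum_add_single {J : ℕ} (b : Fin J → ℕ) (i : Fin J) (j : ℕ) :
    prefixSum (b + Pi.single i 1) j = prefixSum b j + if i.val < j then 1 else 0 := by
  simp [prefixSum, sum_add_distrib, sum_pi_single']

/-- The walk with steps `bᵢ - 1` attains its maximum at time `m`. -/
def IsMaxAt {J : ℕ} (b : Fin J → ℕ) (m : ℕ) : Prop :=
  ∀ j ≤ J, prefixSum b j + m ≤ prefixSum b m + j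

theorem exists_isMaxAt {J : ℕ} (b : Fin J → ℕ) : ∃ m ∈ range (J + 1), IsMaxAt b m := by
  obtain ⟨m, hm, hmax⟩ := exists_max_image (range (J + 1)) (fun m => (prefixSum b m : ℤ) - m)
    ⟨0, by simp⟩
  refine ⟨m, hm, fun j hj => ?_⟩
  have := hmax j (mem_range.mpr (by omega))
  omega

/-- A weakening of `IsMaxAt` that survives the removal of one element from an early block. -/
def IsNearMaxAt {J : ℕ} (b : Fin J → ℕ) (m : ℕ) : Prop :=
  (∀ j ≤ m, prefixSum b j + m ≤ prefixSum b m + j + 1) ∧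
    ∀ j ≤ J, m ≤ j → prefixSum b j + m ≤ prefixSum b m + j

theorem IsMaxAt.isNearMaxAt {J m : ℕ} {b : Fin J → ℕ} (hm : m ≤ J) (h : IsMaxAt b m) :
    IsNearMaxAt b m :=
  ⟨fun j hj => (h j (hj.trans hm)).trans (Nat.le_succ _), fun j hj _ => h j hj⟩

/-- Removing the point lowers the prefix sums after block `i`, including that at `m`, so only times
`j ≤ i` can gain, and by one. -/
theorem IsMaxAt.isNearMaxAt_of_add_single {J m : ℕ} {b : Fin J → ℕ} {i : Fin J} (hm : m ≤ J)
    (hi : i.val < m) (h : IsMaxAt (b + Pi.single i 1) m) : IsNearMaxAt b m := by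
  simp only [IsMaxAt, prefixSum_add_single, if_pos hi] at h
  refine ⟨fun j hj => ?_, fun j hj hmj => ?_⟩
  · have := h j (hj.trans hm)
    omega
  · have := h j hj
    rw [if_pos (by omega)] at this
    omega

theorem prefixSum_append_of_le {m n : ℕ} (p : Fin m → ℕ) (q : Fin n → ℕ) {j : ℕ} (hj : j ≤ m) :
    prefixSum (Fin.append p q) j = prefixSum p j := by
  simp only [prefixSum, sum_filter, Fin.sum_univ_add, Fin.val_castAdd, Fin.append_left,
    Fin.val_natAdd, Fin.append_right, add_eq_left]
  exact sum_eq_zero fun i _ => if_neg (by omega)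

theorem prefixSum_append_add {m n : ℕ} (p : Fin m → ℕ) (q : Fin n → ℕ) (j : ℕ) :
    prefixSum (Fin.append p q) (m + j) = ∑ i, p i + prefixSum q j := by
  simp only [prefixSum, sum_filter, Fin.sum_univ_add, Fin.val_castAdd, Fin.append_left,
    Fin.val_natAdd, Fin.append_right, Nat.add_lt_add_iff_left]
  congr 1
  exact sum_congr rfl fun i _ => if_pos (by omega)

theorem prefixSum_append_self {m n : ℕ} (p : Fin m → ℕ) (q : Fin n → ℕ) :
    prefixSum (Fin.append p q) m = ∑ i, p i := by
  simpa [prefixSum] using prefixSum_append_add p q 0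

theorem IsNearMaxAt.endsNearMax {m n : ℕ} {p : Fin m → ℕ} {q : Fin n → ℕ}
    (h : IsNearMaxAt (Fin.append p q) m) : EndsNearMax p := by
  intro j hj
  have h1 := h.1 j hj
  rw [prefixSum_append_of_le p q hj, prefixSum_append_self, prefixSum] at h1
  have h2 := sum_filter_add_sum_filter_not univ (fun i : Fin m => i.val < j) p
  simp only [not_lt] at h2
  omega

theorem IsNearMaxAt.staysNonpos {m n : ℕ} {p : Fin m → ℕ} {q : Fin n → ℕ}
    (h : IsNearMaxAt (Fin.append p q) m) : StaysNonpos q := by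
  intro j hj
  have h1 := h.2 (m + j) (by omega) (by omega)
  rw [prefixSum_append_add p q, prefixSum_append_self, prefixSum] at h1
  omega

open Classical in
-- The weight is a product over the two sides of the cut, and the power of two doubles the parameter
-- on the right.
theorem tsum_isNearMaxAt_le (m n : ℕ) {x : ℝ≥0∞} :
    ∑' b : Fin (m + n) → ℕ, poissonWeight (fun _ => x) b *
      (if IsNearMaxAt b m then 2 ^ ∑ i with m ≤ i.val, b i else 0) ≤
    (∑' p : Fin m → ℕ, poissonWeight (fun _ => x) p * (if EndsNearMax p then 1 else 0)) *
      ∑' q : Fin n → ℕ, poissonWeight (fun _ => 2 * x) q * (if StaysNonpos q then 1 else 0) := by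
  rw [tsum_fin_append, ← ENNReal.tsum_mul_right]
  refine ENNReal.tsum_le_tsum fun p => ?_
  rw [← ENNReal.tsum_mul_left]
  refine ENNReal.tsum_le_tsum fun q => ?_
  by_cases h : IsNearMaxAt (Fin.append p q) m
  swap
  · simp [h]
  rw [if_pos h, if_pos h.endsNearMax, if_pos h.staysNonpos, poissonWeight_append,
    poissonWeight_const (2 * x), poissonWeight_const x q, mul_pow]
  simp only [sum_filter, Fin.sum_univ_add, Fin.val_castAdd, Fin.append_left, Fin.val_natAdd,
    Fin.append_right, Nat.le_add_right, if_true]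
  rw [sum_eq_zero fun i _ => if_neg (by omega), zero_add]
  apply le_of_eq
  ring

theorem one_add_sum_two_pow_le (J m : ℕ) :
    1 + ∑ i : Fin J with i.val < m, 2 ^ (i.val + 1) ≤ 2 ^ (m + 1) := by
  have h1 : ∑ i : Fin J with i.val < m, 2 ^ (i.val + 1) ≤ ∑ i ∈ range m, 2 ^ (i + 1) := by
    rw [sum_filter, Fin.sum_univ_eq_sum_range (fun i => if i < m then 2 ^ (i + 1) else 0),
      ← sum_filter]
    exact sum_le_sum_of_subset fun i hi => by simpa using (mem_filter.mp hi).2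
  have h2 : ∀ m, ∑ i ∈ range m, 2 ^ (i + 1) + 2 = 2 ^ (m + 1) := by
    intro m
    induction m with
    | zero => simp
    | succ m ih => rw [sum_range_succ, pow_succ 2 (m + 1), ← ih]; ring
  have := h2 m
  omega

/-- The bound on the number of subset sums in terms of the block counts `b`, obtained by keeping
all subsets of the blocks from `m` on and bounding the sums over the earlier blocks. -/
def blockBound {J : ℕ} (b : Fin J → ℕ) (m : ℕ) : ℕ :=
  2 ^ (∑ i with m ≤ i.val, b i) * (1 + ∑ i : Fin J with i.val < m, 2 ^ (i.val + 1) * b i)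

open Classical in
-- Mecke's formula absorbs each linear factor `b i` by adding a point to block `i`, at cost `x ≤ 1`.
-- What remains is `1 + ∑ 2 ^ (i + 1)` over `i < m`.
theorem tsum_isMaxAt_le (m n : ℕ) {x : ℝ≥0∞} (hx : x ≤ 1) :
    ∑' b : Fin (m + n) → ℕ, poissonWeight (fun _ => x) b *
      (if IsMaxAt b m then (blockBound b m : ℝ≥0∞) else 0) ≤
    2 ^ (m + 1) * ∑' b : Fin (m + n) → ℕ, poissonWeight (fun _ => x) b *
      (if IsNearMaxAt b m then 2 ^ ∑ i with m ≤ i.val, b i else 0) := by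
  have hm : m ≤ m + n := Nat.le_add_right m n
  set Z := ∑' b : Fin (m + n) → ℕ, poissonWeight (fun _ => x) b *
      (if IsNearMaxAt b m then (2 : ℝ≥0∞) ^ ∑ i with m ≤ i.val, b i else 0) with hZ
  set g : (Fin (m + n) → ℕ) → ℝ≥0∞ := fun b =>
    if IsMaxAt b m then (2 : ℝ≥0∞) ^ ∑ i with m ≤ i.val, b i else 0 with hg
  have hsplit : ∀ b : Fin (m + n) → ℕ, poissonWeight (fun _ => x) b *
      (if IsMaxAt b m then (blockBound b m : ℝ≥0∞) else 0) =
      poissonWeight (fun _ => x) b * g b + ∑ i : Fin (m + n) with i.val < m,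
        2 ^ (i.val + 1) * ((b i : ℝ≥0∞) * (poissonWeight (fun _ => x) b * g b)) := by
    intro b
    simp only [hg]
    split_ifs
    · rw [blockBound]
      push_cast
      rw [mul_add, mul_one, mul_add, mul_sum, mul_sum]
      congr 1
      exact sum_congr rfl fun i _ => by ring
    · simp
  have h0 : ∑' b, poissonWeight (fun _ => x) b * g b ≤ Z := by
    refine ENNReal.tsum_le_tsum fun b => mul_le_mul_right ?_ _
    simp only [hg]
    split_ifs with h1 h2
    · exact le_rfl
    · exact absurd (h1.isNearMaxAt hm) h2
    · exact zero_le
    · exact zero_le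
  have h1 : ∀ i : Fin (m + n), i.val < m →
      ∑' b, (b i : ℝ≥0∞) * (poissonWeight (fun _ => x) b * g b) ≤ Z := by
    intro i hi
    rw [tsum_mul_poissonWeight]
    refine (mul_le_of_le_one_left zero_le hx).trans ?_
    refine ENNReal.tsum_le_tsum fun b => mul_le_mul_right ?_ _
    simp only [hg]
    split_ifs with h1 h2
    · refine le_of_eq (congrArg _ (sum_congr rfl fun j hj => ?_))
      have : j ≠ i := by
        rintro rfl
        have := (mem_filter.mp hj).2
        omega
      simp [this]
    · exact absurd (h1.isNearMaxAt_of_add_single hm hi) h2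
    · exact zero_le
    · exact zero_le
  simp only [hsplit]
  rw [ENNReal.tsum_add, Summable.tsum_finsetSum fun _ _ => ENNReal.summable]
  simp only [ENNReal.tsum_mul_left]
  refine (add_le_add h0 (sum_le_sum fun i hi =>
    mul_le_mul_right (h1 i (mem_filter.mp hi).2) _)).trans ?_
  rw [← sum_mul]
  calc _ = ((1 + ∑ i : Fin (m + n) with i.val < m, 2 ^ (i.val + 1) : ℕ) : ℝ≥0∞) * Z := by
        push_cast
        rw [add_mul, one_mul]
    _ ≤ ((2 ^ (m + 1) : ℕ) : ℝ≥0∞) * Z := by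
        gcongr
        exact one_add_sum_two_pow_le _ m
    _ = _ := by push_cast; rfl

open Classical in
theorem exists_tsum_blockBound_le : ∃ C : ℝ, 0 < C ∧ ∀ J : ℕ,
    ∑ m ∈ range (J + 1), ∑' b : Fin J → ℕ,
      poissonWeight (fun _ => ENNReal.ofReal (Real.log 2)) b *
        (if IsMaxAt b m then (blockBound b m : ℝ≥0∞) else 0) ≤
    ENNReal.ofReal (C * ((2 * Real.exp 1 * Real.log 2) ^ J * ((J : ℝ) + 1) ^ (-(3 / 2) : ℝ))) := by
  obtain ⟨C₁, hC₁, h₁⟩ := exists_tsum_endsNearMax_le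
  obtain ⟨C₂, hC₂, h₂⟩ := exists_tsum_staysNonpos_le
  obtain ⟨C₃, hC₃, h₃⟩ := exists_convolution_le
  have hlog : 0 < Real.log 2 := Real.log_pos one_lt_two
  refine ⟨2 * C₁ * C₂ * C₃, by positivity, fun J => ?_⟩
  have hterm : ∀ m ∈ range (J + 1), ∑' b : Fin J → ℕ,
      poissonWeight (fun _ => ENNReal.ofReal (Real.log 2)) b *
        (if IsMaxAt b m then (blockBound b m : ℝ≥0∞) else 0) ≤
      ENNReal.ofReal (2 * C₁ * C₂ * (2 * Real.exp 1 * Real.log 2) ^ J *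
        (((m : ℝ) + 1) ^ (-(3 / 2) : ℝ) * (((J - m : ℕ) : ℝ) + 1) ^ (-(3 / 2) : ℝ))) := by
    intro m hm
    obtain ⟨n, rfl⟩ := Nat.exists_eq_add_of_le (Nat.lt_succ_iff.mp (mem_range.mp hm))
    have hx : ENNReal.ofReal (Real.log 2) ≤ 1 := by
      rw [ENNReal.ofReal_le_one]
      have := Real.log_two_lt_d9
      linarith
    refine (tsum_isMaxAt_le m n hx).trans ?_
    refine (mul_le_mul_right (tsum_isNearMaxAt_le m n) _).trans ?_
    have h2 : (2 : ℝ≥0∞) * ENNReal.ofReal (Real.log 2) = ENNReal.ofReal (2 * Real.log 2) := by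
      rw [ENNReal.ofReal_mul zero_le_two, ENNReal.ofReal_ofNat]
    rw [h2]
    refine (mul_le_mul_right (mul_le_mul' (h₁ m) (h₂ n)) _).trans_eq ?_
    rw [← ENNReal.ofReal_ofNat 2, ← ENNReal.ofReal_pow zero_le_two,
      ← ENNReal.ofReal_mul (by positivity), ← ENNReal.ofReal_mul (by positivity)]
    congr 1
    rw [Nat.add_sub_cancel_left, pow_add (2 * Real.exp 1 * Real.log 2) m n, mul_pow _ _ m,
      mul_pow _ _ m, mul_pow _ _ m]
    ring
  refine (sum_le_sum hterm).trans ?_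
  rw [← ENNReal.ofReal_sum_of_nonneg fun m _ => by positivity, ← mul_sum]
  refine ENNReal.ofReal_le_ofReal ?_
  calc _ ≤ 2 * C₁ * C₂ * (2 * Real.exp 1 * Real.log 2) ^ J *
        (C₃ * ((J : ℝ) + 1) ^ (-(3 / 2) : ℝ)) := by
        gcongr
        exact h₃ J
    _ = _ := by ring

/-! ### Dyadic blocks and the upper bound for the Poisson sum -/

theorem sum_mul_fiberSum {ι κ M : Type*} [Fintype ι] [Fintype κ] [DecidableEq κ]
    [NonUnitalNonAssocSemiring M] (f : ι → κ) (w : κ → M) (c : ι → M) :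
    ∑ i, w i * fiberSum f c i = ∑ j, w (f j) * c j := by
  rw [← sum_fiberwise univ f]
  refine sum_congr rfl fun i _ => ?_
  rw [fiberSum, mul_sum]
  exact sum_congr rfl fun j hj => by rw [(mem_filter.mp hj).2]

theorem sum_filter_mul_fiberSum {ι κ : Type*} [Fintype ι] [Fintype κ] [DecidableEq κ] (f : ι → κ)
    (w : κ → ℕ) (c : ι → ℕ) (P : κ → Prop) [DecidablePred P] :
    ∑ i with P i, w i * fiberSum f c i = ∑ j with P (f j), w (f j) * c j := by
  have h := sum_mul_fiberSum f (fun i => if P i then w i else 0) c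
  simpa only [ite_mul, zero_mul, ← sum_filter] using h

/-- The dyadic block containing `j + 2`: block `i` is `(2 ^ i, 2 ^ (i + 1)]`. -/
def upperBlock (k : ℕ) (j : Fin k) : Fin (Nat.log 2 k + 1) :=
  ⟨Nat.log 2 (j + 1), Nat.lt_succ_of_le (Nat.log_mono_right (by omega))⟩

theorem card_sumSet_cons_le_blockBound {k : ℕ} (t : ℕ) (c : Fin k → ℕ) (m : ℕ) :
    #(sumSet (Fin.cons t c : Fin (k + 1) → ℕ)) ≤
      2 ^ t * blockBound (fiberSum (upperBlock k) c) m := by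
  classical
  -- The integer `1` lies in no block; it is always kept, which costs `2 ^ t`.
  set P : Fin (k + 1) → Prop := Fin.cases True fun j => m ≤ (upperBlock k j).val with hP
  refine (card_sumSet_le _ (univ.filter P)).trans ?_
  rw [compl_filter, sum_filter, sum_filter, Fin.sum_univ_succ, Fin.sum_univ_succ]
  simp only [hP, Fin.cases_zero, Fin.cases_succ, not_true_eq_false, if_true, if_false,
    Fin.cons_zero, Fin.cons_succ, zero_add, ← sum_filter, not_le, pow_add, mul_assoc]
  refine Nat.mul_le_mul_left _ ?_
  have h1 := sum_filter_mul_fiberSum (upperBlock k) (fun _ => 1) c (fun i => m ≤ i.val)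
  have h2 := sum_filter_mul_fiberSum (upperBlock k) (fun i => 2 ^ (i.val + 1)) c
    (fun i => i.val < m)
  simp only [one_mul] at h1
  rw [blockBound, h1, h2]
  gcongr with j hj
  rw [Fin.val_succ]
  exact Nat.lt_pow_succ_log_self one_lt_two _

open Classical in
theorem card_sumSet_cons_le_sum {k : ℕ} (t : ℕ) (c : Fin k → ℕ) :
    (#(sumSet (Fin.cons t c : Fin (k + 1) → ℕ)) : ℝ≥0∞) ≤
      2 ^ t * ∑ m ∈ range (Nat.log 2 k + 1 + 1),
        if IsMaxAt (fiberSum (upperBlock k) c) m then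
          (blockBound (fiberSum (upperBlock k) c) m : ℝ≥0∞) else 0 := by
  obtain ⟨m, hm, hmax⟩ := exists_isMaxAt (fiberSum (upperBlock k) c)
  calc _ ≤ ((2 ^ t * blockBound (fiberSum (upperBlock k) c) m : ℕ) : ℝ≥0∞) := by
        exact_mod_cast card_sumSet_cons_le_blockBound t c m
    _ = 2 ^ t * if IsMaxAt (fiberSum (upperBlock k) c) m then
          (blockBound (fiberSum (upperBlock k) c) m : ℝ≥0∞) else 0 := by
        rw [if_pos hmax]; push_cast; rfl
    _ ≤ _ := by
        gcongr
        exact single_le_sum (f := fun m => if IsMaxAt (fiberSum (upperBlock k) c) m then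
          (blockBound (fiberSum (upperBlock k) c) m : ℝ≥0∞) else 0) (fun _ _ => zero_le) hm

theorem one_div_succ_le_log (u : ℕ) (hu : 0 < u) :
    1 / ((u : ℝ) + 1) ≤ Real.log (u + 1) - Real.log u := by
  have hu' : (0 : ℝ) < u := by exact_mod_cast hu
  rw [← Real.log_div (by positivity) hu'.ne']
  have h := Real.one_sub_inv_le_log_of_pos (x := ((u : ℝ) + 1) / u) (by positivity)
  refine le_trans (le_of_eq ?_) h
  field_simp
  ring

theorem log_le_one_div (u : ℕ) (hu : 0 < u) :
    Real.log (u + 1) - Real.log u ≤ 1 / (u : ℝ) := by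
  have hu' : (0 : ℝ) < u := by exact_mod_cast hu
  rw [← Real.log_div (by positivity) hu'.ne']
  refine (Real.log_le_sub_one_of_pos (by positivity)).trans (le_of_eq ?_)
  field_simp
  ring

theorem sum_log_sub_dyadic (i : ℕ) :
    ∑ u ∈ Ico ((2 : ℕ) ^ i) (2 ^ (i + 1)), (Real.log ((u : ℝ) + 1) - Real.log u) = Real.log 2 := by
  have h := sum_Ico_sub (fun u : ℕ => Real.log u)
    (Nat.pow_le_pow_right (show 0 < 2 by norm_num) i.le_succ)
  push_cast at h
  refine h.trans ?_
  rw [← Real.log_div (by positivity) (by positivity), pow_succ]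
  congr 1
  field_simp

/-- Closing the blocks on the right makes each reciprocal `1 / (u + 1)` at most the integral of `1 /
x` over `[u, u + 1]`. -/
theorem fiberSum_upperBlock_le (k : ℕ) (i : Fin (Nat.log 2 k + 1)) :
    fiberSum (upperBlock k) (fun j : Fin k => ENNReal.ofReal (1 / ((j : ℕ) + 2 : ℝ))) i ≤
      ENNReal.ofReal (Real.log 2) := by
  rw [fiberSum, ← ENNReal.ofReal_sum_of_nonneg fun j _ => by positivity]
  refine ENNReal.ofReal_le_ofReal ?_
  rw [← sum_log_sub_dyadic i.val]
  have hinj : Set.InjOn (fun j : Fin k => j.val + 1)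
      (univ.filter fun j => upperBlock k j = i : Finset (Fin k)) :=
    fun a _ b _ h => Fin.ext (by simpa using h)
  calc _ = ∑ u ∈ (univ.filter fun j => upperBlock k j = i).image fun j : Fin k => j.val + 1,
          1 / ((u : ℝ) + 1) := by
        rw [sum_image hinj]
        refine sum_congr rfl fun j _ => ?_
        push_cast
        ring
    _ ≤ ∑ u ∈ Ico ((2 : ℕ) ^ i.val) (2 ^ (i.val + 1)), 1 / ((u : ℝ) + 1) := by
        refine sum_le_sum_of_subset_of_nonneg ?_ fun _ _ _ => by positivity
        intro u hu
        obtain ⟨j, hj, rfl⟩ := mem_image.mp hu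
        have hj' : Nat.log 2 (j.val + 1) = i.val := congrArg Fin.val (mem_filter.mp hj).2
        rw [mem_Ico, ← hj']
        exact ⟨Nat.pow_log_le_self 2 (by omega), Nat.lt_pow_succ_log_self one_lt_two _⟩
    _ ≤ _ := by
        refine sum_le_sum fun u hu => one_div_succ_le_log u ?_
        exact lt_of_lt_of_le (by positivity) (mem_Ico.mp hu).1

theorem tsum_two_pow_div_factorial :
    ∑' t : ℕ, (2 : ℝ≥0∞) ^ t / (t ! : ℝ≥0∞) = ENNReal.ofReal (Real.exp 2) := by
  have h := NormedSpace.expSeries_div_hasSum_exp (2 : ℝ)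
  rw [← Real.exp_eq_exp_ℝ] at h
  rw [← h.tsum_eq, ENNReal.ofReal_tsum_of_nonneg (fun t => by positivity) h.summable]
  refine tsum_congr fun t => ?_
  rw [ENNReal.ofReal_div_of_pos (by positivity), ENNReal.ofReal_pow zero_le_two]
  simp

theorem exists_tsum_card_sumSet_le : ∃ C : ℝ, 0 < C ∧ ∀ k : ℕ,
    ∑' c : Fin (k + 1) → ℕ, poissonWeight (fun j : Fin (k + 1) => ENNReal.ofReal (1 / ((j : ℕ) + 1 : ℝ))) c *
      (#(sumSet c) : ℝ≥0∞) ≤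
    ENNReal.ofReal (C * ((2 * Real.exp 1 * Real.log 2) ^ (Nat.log 2 k + 1) *
      (((Nat.log 2 k + 1 : ℕ) : ℝ) + 1) ^ (-(3 / 2) : ℝ))) := by
  classical
  obtain ⟨C, hC, h⟩ := exists_tsum_blockBound_le
  refine ⟨Real.exp 2 * C, by positivity, fun k => ?_⟩
  set J := Nat.log 2 k + 1 with hJ
  set G : (Fin J → ℕ) → ℝ≥0∞ := fun b => ∑ m ∈ range (J + 1),
    if IsMaxAt b m then (blockBound b m : ℝ≥0∞) else 0 with hG
  have hinner : ∑' c : Fin k → ℕ, poissonWeight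
      (fun j : Fin k => ENNReal.ofReal (1 / ((j : ℕ) + 2 : ℝ))) c *
        G (fiberSum (upperBlock k) c) ≤
      ENNReal.ofReal (C * ((2 * Real.exp 1 * Real.log 2) ^ J * ((J : ℝ) + 1) ^ (-(3 / 2) : ℝ))) := by
    rw [tsum_poissonWeight_fiberSum]
    refine le_trans (ENNReal.tsum_le_tsum fun b => mul_le_mul_left
      (poissonWeight_mono (fiberSum_upperBlock_le k) b) _) (le_trans (le_of_eq ?_) (h J))
    simp only [hG, mul_sum]
    rw [Summable.tsum_finsetSum fun _ _ => ENNReal.summable]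
  -- The multiplicity `t` of the integer `1` contributes only `∑ 2 ^ t / t! = e ^ 2`.
  rw [tsum_fin_cons, mul_assoc (Real.exp 2), ENNReal.ofReal_mul (by positivity),
    ← tsum_two_pow_div_factorial, ← ENNReal.tsum_mul_right]
  refine ENNReal.tsum_le_tsum fun t => ?_
  refine le_trans ?_ (mul_le_mul_right hinner _)
  rw [← ENNReal.tsum_mul_left]
  refine ENNReal.tsum_le_tsum fun c => ?_
  refine (mul_le_mul_right (card_sumSet_cons_le_sum t c) _).trans (le_of_eq ?_)
  rw [poissonWeight_cons]
  simp only [Fin.val_zero, Fin.val_succ, Nat.cast_zero, zero_add, div_one, ENNReal.ofReal_one,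
    one_pow, Nat.cast_add, Nat.cast_one, add_assoc, one_add_one_eq_two, hG, ← hJ]
  rw [div_eq_mul_inv, div_eq_mul_inv]
  ring

/-! ### Lower bound: coincidences among subset sums -/

theorem sq_card_le_card_image_mul {α β : Type*} [Fintype α] [DecidableEq β] (s : α → β) :
    Fintype.card α ^ 2 ≤ #(univ.image s) * ∑ a, #{b | s a = s b} := by
  have h1 : Fintype.card α = ∑ n ∈ univ.image s, #{a | s a = n} := by
    rw [← card_univ]
    exact card_eq_sum_card_image s univ
  have h2 : ∑ a, #{b | s a = s b} = ∑ n ∈ univ.image s, #{a | s a = n} ^ 2 := by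
    rw [← sum_fiberwise_of_maps_to (g := s) (t := univ.image s) fun a _ => mem_image_of_mem s
      (mem_univ a)]
    refine sum_congr rfl fun n _ => ?_
    rw [sq, ← smul_eq_mul, ← sum_const]
    refine sum_congr rfl fun a ha => ?_
    rw [(mem_filter.mp ha).2]
    simp only [eq_comm]
  rw [h1, h2]
  exact sq_sum_le_card_mul_sum_sq

section SubsetSums

variable {r : ℕ}

/-- The set of subset sums of the tuple `v`. -/
def subsetSums (v : Fin r → ℕ) : Finset ℕ :=
  univ.image fun Y : Finset (Fin r) => ∑ i ∈ Y, v i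

/-- The reciprocal of the product of the entries of `v`. -/
noncomputable def recipProd (v : Fin r → ℕ) : ℝ := ∏ i, 1 / (v i : ℝ)

theorem recipProd_nonneg (v : Fin r → ℕ) : 0 ≤ recipProd v := prod_nonneg fun i _ => by positivity

/-- The tuples whose `i`-th entry lies in the dyadic block `[2 ^ g i, 2 ^ (g i + 1))`. -/
def dyadicBox (g : Fin r → ℕ) : Finset (Fin r → ℕ) :=
  Fintype.piFinset fun i => Ico (2 ^ g i) (2 ^ (g i + 1))

/-- The sum of the reciprocals over a dyadic block. -/
noncomputable def blockMass (i : ℕ) : ℝ := ∑ n ∈ Ico ((2 : ℕ) ^ i) (2 ^ (i + 1)), 1 / (n : ℝ)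

theorem log_two_le_blockMass (i : ℕ) : Real.log 2 ≤ blockMass i := by
  rw [← sum_log_sub_dyadic i]
  exact sum_le_sum fun u hu =>
    log_le_one_div u (lt_of_lt_of_le (by positivity) (mem_Ico.mp hu).1)

theorem sum_recipProd (g : Fin r → ℕ) :
    ∑ v ∈ dyadicBox g, recipProd v = ∏ i, blockMass (g i) := by
  simp only [blockMass, prod_univ_sum]
  rfl

/-- As `ε s ≠ 0`, the relation determines `v s` from the other entries, so a single reciprocal, at
most `2 ^ (-g s)`, replaces the mass of a whole block. -/
theorem blockMass_mul_sum_recipProd_le {g : Fin r → ℕ} {s : Fin r} (ε : Fin r → ℤ)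
    (hs : ε s ≠ 0) :
    blockMass (g s) * ∑ v ∈ dyadicBox g with ∑ i, ε i * (v i : ℤ) = 0, recipProd v ≤
      (1 / 2) ^ g s * ∏ i, blockMass (g i) := by
  set S : Finset (Fin r → ℕ) := {v ∈ dyadicBox g | ∑ i, ε i * (v i : ℤ) = 0} with hS
  -- Coordinate `s` is erased by giving it the dummy value `0` with weight `1`.
  set D : Fin r → Finset ℕ :=
    fun i => if i = s then {0} else Ico (2 ^ g i) (2 ^ (g i + 1)) with hD
  set F : Fin r → ℕ → ℝ := fun i n => if i = s then 1 else 1 / (n : ℝ) with hF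
  have hF0 : ∀ i n, 0 ≤ F i n := fun i n => by simp only [hF]; split_ifs <;> positivity
  have hrest : ∑ w ∈ Fintype.piFinset D, ∏ i, F i (w i) = ∏ i ∈ {s}ᶜ, blockMass (g i) := by
    rw [← prod_univ_sum, Fintype.prod_eq_mul_prod_compl s]
    simp only [hD, hF, if_true, sum_singleton, one_mul]
    refine prod_congr rfl fun i hi => ?_
    have : i ≠ s := by simpa using hi
    simp [this, blockMass]
  have hpoint : ∀ v ∈ S, recipProd v ≤ (1 / 2) ^ g s * ∏ i, F i (Function.update v s 0 i) := by
    intro v hv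
    have hvs := (mem_Ico.mp (Fintype.mem_piFinset.mp (mem_filter.mp hv).1 s)).1
    have hvs' : ((2 : ℝ) ^ g s) ≤ v s := by exact_mod_cast hvs
    rw [recipProd, Fintype.prod_eq_mul_prod_compl s, Fintype.prod_eq_mul_prod_compl s]
    simp only [hF, if_true, one_mul]
    gcongr ?_ * ?_
    · rw [one_div_pow]
      gcongr
    · refine le_of_eq (prod_congr rfl fun i hi => ?_)
      have : i ≠ s := by simpa using hi
      simp [this]
  have hinj : Set.InjOn (fun v : Fin r → ℕ => Function.update v s 0) S := by
    intro v hv w hw hvw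
    have hne : ∀ i, i ≠ s → v i = w i := fun i hi => by
      simpa [hi] using congrFun hvw i
    have hv0 := (mem_filter.mp hv).2
    have hw0 := (mem_filter.mp hw).2
    have hdiff : ∑ i, ε i * ((v i : ℤ) - w i) = 0 := by
      simp only [mul_sub, sum_sub_distrib]
      rw [hv0, hw0, sub_zero]
    rw [Fintype.sum_eq_single s fun i hi => by rw [hne i hi, sub_self, mul_zero]] at hdiff
    funext i
    rcases eq_or_ne i s with rfl | hi
    · have := (mul_eq_zero.mp hdiff).resolve_left hs
      omega
    · exact hne i hi
  have hsub : S.image (fun v => Function.update v s 0) ⊆ Fintype.piFinset D := by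
    intro w hw
    obtain ⟨v, hv, rfl⟩ := mem_image.mp hw
    rw [Fintype.mem_piFinset]
    intro i
    rcases eq_or_ne i s with rfl | hi
    · simp [hD]
    · have := Fintype.mem_piFinset.mp (mem_filter.mp hv).1 i
      simpa [hD, hi] using this
  have hmass : 0 ≤ blockMass (g s) := sum_nonneg fun _ _ => by positivity
  calc _ ≤ blockMass (g s) * ∑ v ∈ S, (1 / 2) ^ g s * ∏ i, F i (Function.update v s 0 i) := by
        gcongr with v hv
        exact hpoint v hv
    _ = blockMass (g s) * ((1 / 2) ^ g s *
        ∑ w ∈ S.image (fun v => Function.update v s 0), ∏ i, F i (w i)) := by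
        rw [← mul_sum, sum_image hinj]
    _ ≤ blockMass (g s) * ((1 / 2) ^ g s * ∑ w ∈ Fintype.piFinset D, ∏ i, F i (w i)) := by
        gcongr
    _ = _ := by
        rw [hrest, Fintype.prod_eq_mul_prod_compl s]
        ring

theorem sum_boole_symmDiff_subset (T : Finset (Fin r)) :
    ∑ Y : Finset (Fin r), ∑ Y' : Finset (Fin r), (if symmDiff Y Y' ⊆ T then (1 : ℝ) else 0) =
      2 ^ r * 2 ^ #T := by
  have h : ∀ Y : Finset (Fin r),
      ∑ Y' : Finset (Fin r), (if symmDiff Y Y' ⊆ T then (1 : ℝ) else 0) = 2 ^ #T := by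
    intro Y
    refine (Equiv.sum_comp (symmDiff_right_involutive Y).toPerm
      (fun Z => if Z ⊆ T then (1 : ℝ) else 0)).trans ?_
    rw [sum_boole, filter_subset_univ, card_powerset]
    push_cast
    rfl
  simp [h]

/-- The sum controlling the number of coincidences among subset sums in a dyadic box. -/
noncomputable def coincidenceSum {J : ℕ} (g : Fin J → Fin J) : ℝ :=
  ∑ j : Fin J, (1 / 2) ^ j.val * 2 ^ #(univ.filter (g · ≤ j))

theorem coincidenceSum_pos {J : ℕ} [NeZero J] (g : Fin J → Fin J) : 0 < coincidenceSum g :=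
  sum_pos (fun j _ => by positivity) ⟨0, mem_univ _⟩

/-- One term on the right suffices: `j` is the highest block met by the symmetric difference, or `0`
when `Y = Y'`. -/
theorem log_two_mul_sum_sum_eq_le {J : ℕ} [NeZero J] (g : Fin J → Fin J) (Y Y' : Finset (Fin J)) :
    Real.log 2 * ∑ v ∈ dyadicBox (fun i => (g i).val) with ∑ i ∈ Y, v i = ∑ i ∈ Y', v i,
        recipProd v ≤
      (∏ i, blockMass (g i)) *
        ∑ j : Fin J, (1 / 2) ^ j.val * if symmDiff Y Y' ⊆ univ.filter (g · ≤ j) then (1 : ℝ) else 0 := by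
  have hlog0 : 0 < Real.log 2 := Real.log_pos one_lt_two
  have hprod : 0 ≤ ∏ i, blockMass (g i) :=
    prod_nonneg fun i _ => hlog0.le.trans (log_two_le_blockMass _)
  have hterm : ∀ j : Fin J, 0 ≤ (1 / 2 : ℝ) ^ j.val *
      if symmDiff Y Y' ⊆ univ.filter (g · ≤ j) then (1 : ℝ) else 0 := fun j => by
    split_ifs <;> positivity
  rcases eq_or_ne Y Y' with rfl | hne
  · have h1 := single_le_sum (fun j _ => hterm j) (mem_univ (0 : Fin J))
    simp only [symmDiff_self, bot_eq_empty, empty_subset, if_true, mul_one, Fin.val_zero,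
      pow_zero] at h1
    simp only [filter_true, symmDiff_self, bot_eq_empty, empty_subset, if_true, mul_one]
    rw [sum_recipProd]
    have h2 : Real.log 2 ≤ 1 := by have := Real.log_two_lt_d9; linarith
    nlinarith
  · obtain ⟨s, hs, hmax⟩ := exists_max_image (symmDiff Y Y') g
      (nonempty_iff_ne_empty.mpr fun h => hne (symmDiff_eq_bot.mp h))
    have h1 := single_le_sum (fun j _ => hterm j) (mem_univ (g s))
    have hsub : symmDiff Y Y' ⊆ univ.filter (g · ≤ g s) := fun i hi => by simpa using hmax i hi
    rw [if_pos hsub, mul_one] at h1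
    set ε : Fin J → ℤ := fun i => (if i ∈ Y then 1 else 0) - if i ∈ Y' then 1 else 0 with hε
    have hεs : ε s ≠ 0 := by
      rcases mem_symmDiff.mp hs with ⟨h, h'⟩ | ⟨h, h'⟩ <;> simp [hε, h, h']
    have hiff : ∀ v : Fin J → ℕ,
        (∑ i ∈ Y, v i = ∑ i ∈ Y', v i) ↔ ∑ i, ε i * (v i : ℤ) = 0 := by
      intro v
      simp only [hε, sub_mul, sum_sub_distrib, ite_mul, one_mul, zero_mul, sum_ite_mem, univ_inter]
      rw [sub_eq_zero]
      norm_cast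
    simp only [hiff]
    have h2 := blockMass_mul_sum_recipProd_le (g := fun i => (g i).val) ε hεs
    have h3 : 0 ≤ ∑ v ∈ dyadicBox (fun i => (g i).val) with ∑ i, ε i * (v i : ℤ) = 0,
        recipProd v := sum_nonneg fun v _ => recipProd_nonneg v
    calc _ ≤ _ := mul_le_mul_of_nonneg_right (log_two_le_blockMass (g s)) h3
      _ ≤ _ := h2
      _ ≤ _ := by
        rw [mul_comm]
        gcongr

/-- Cauchy–Schwarz enters twice: over the subsets for each `v`, and over the box with weights
`recipProd`. -/
theorem sum_recipProd_mul_card_subsetSums_ge {J : ℕ} [NeZero J] (g : Fin J → Fin J) :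
    2 ^ J * Real.log 2 ^ (J + 1) / coincidenceSum g ≤
      ∑ v ∈ dyadicBox (fun i => (g i).val), recipProd v * (#(subsetSums v) : ℝ) := by
  have hlog0 : 0 < Real.log 2 := Real.log_pos one_lt_two
  set P : ℝ := ∏ i, blockMass (g i) with hP
  have hPge : Real.log 2 ^ J ≤ P := by
    have : Real.log 2 ^ J = ∏ _i : Fin J, Real.log 2 := by simp
    rw [this]
    exact prod_le_prod (fun _ _ => hlog0.le) fun i _ => log_two_le_blockMass _
  have hP0 : 0 < P := lt_of_lt_of_le (by positivity) hPge
  set A := dyadicBox (fun i => (g i).val) with hA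
  set E : (Fin J → ℕ) → ℝ := fun v => ∑ Y : Finset (Fin J), ∑ Y' : Finset (Fin J),
    if ∑ i ∈ Y, v i = ∑ i ∈ Y', v i then 1 else 0 with hE
  have hE0 : ∀ v, 0 ≤ E v := fun v => sum_nonneg fun _ _ => sum_nonneg fun _ _ => by
    split_ifs <;> norm_num
  have hcs : (2 ^ J * P) ^ 2 ≤
      (∑ v ∈ A, recipProd v * (#(subsetSums v) : ℝ)) * ∑ v ∈ A, recipProd v * E v := by
    have h1 : 2 ^ J * P = ∑ v ∈ A, recipProd v * 2 ^ J := by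
      rw [← sum_mul, hA, sum_recipProd, mul_comm]
    rw [h1]
    refine sum_sq_le_sum_mul_sum_of_sq_le_mul _
      (fun v _ => mul_nonneg (recipProd_nonneg v) (Nat.cast_nonneg _))
      (fun v _ => mul_nonneg (recipProd_nonneg v) (hE0 v)) fun v _ => ?_
    have h2 := sq_card_le_card_image_mul fun Y : Finset (Fin J) => ∑ i ∈ Y, v i
    rw [Fintype.card_finset, Fintype.card_fin] at h2
    have h3 : ((2 : ℝ) ^ J) ^ 2 ≤ #(subsetSums v) * E v := by
      have h4 : ((∑ Y : Finset (Fin J), #{Y' : Finset (Fin J) | ∑ i ∈ Y, v i = ∑ i ∈ Y', v i} : ℕ) :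
          ℝ) = E v := by
        simp only [hE, sum_boole]
        push_cast
        rfl
      rw [← h4]
      exact_mod_cast h2
    have h5 := recipProd_nonneg v
    calc _ = recipProd v * recipProd v * ((2 : ℝ) ^ J) ^ 2 := by ring
      _ ≤ recipProd v * recipProd v * (#(subsetSums v) * E v) := by gcongr
      _ = _ := by ring
  have henergy : Real.log 2 * ∑ v ∈ A, recipProd v * E v ≤ P * 2 ^ J * coincidenceSum g := by
    have h1 : ∑ v ∈ A, recipProd v * E v = ∑ Y : Finset (Fin J), ∑ Y' : Finset (Fin J),
        ∑ v ∈ A with ∑ i ∈ Y, v i = ∑ i ∈ Y', v i, recipProd v := by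
      simp only [hE, mul_sum, mul_ite, mul_one, mul_zero, sum_filter]
      rw [sum_comm]
      exact sum_congr rfl fun Y _ => sum_comm
    rw [h1]
    simp only [mul_sum]
    calc _ ≤ ∑ Y : Finset (Fin J), ∑ Y' : Finset (Fin J), P *
          ∑ j : Fin J, (1 / 2) ^ j.val * if symmDiff Y Y' ⊆ univ.filter (g · ≤ j) then (1 : ℝ) else 0 := by
          refine sum_le_sum fun Y _ => sum_le_sum fun Y' _ => ?_
          rw [← mul_sum]
          exact log_two_mul_sum_sum_eq_le g Y Y'
      _ = P * ∑ j : Fin J, (1 / 2) ^ j.val * ∑ Y : Finset (Fin J), ∑ Y' : Finset (Fin J),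
          if symmDiff Y Y' ⊆ univ.filter (g · ≤ j) then (1 : ℝ) else 0 := by
          simp only [← mul_sum]
          congr 1
          rw [sum_congr rfl fun Y _ => sum_comm, sum_comm]
          simp only [← mul_sum]
      _ = _ := by
          simp only [sum_boole_symmDiff_subset, coincidenceSum, mul_sum]
          exact sum_congr rfl fun j _ => by ring
  set L := ∑ v ∈ A, recipProd v * (#(subsetSums v) : ℝ) with hL
  have hL0 : 0 ≤ L := sum_nonneg fun v _ => mul_nonneg (recipProd_nonneg v) (Nat.cast_nonneg _)
  rw [div_le_iff₀ (coincidenceSum_pos g)]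
  have hcomb : 2 ^ J * P * (2 ^ J * P * Real.log 2) ≤ 2 ^ J * P * (L * coincidenceSum g) := by
    calc _ = Real.log 2 * (2 ^ J * P) ^ 2 := by ring
      _ ≤ Real.log 2 * (L * ∑ v ∈ A, recipProd v * E v) := by gcongr
      _ = L * (Real.log 2 * ∑ v ∈ A, recipProd v * E v) := by ring
      _ ≤ L * (P * 2 ^ J * coincidenceSum g) := by gcongr
      _ = _ := by ring
  refine le_trans ?_ (le_of_mul_le_mul_left hcomb (by positivity))
  rw [pow_succ, ← mul_assoc]
  gcongr

end SubsetSums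

/-! ### Averaging over cyclic rotations -/

theorem sum_range_add_of_periodic {J : ℕ} {h : ℕ → ℝ} (hper : ∀ n, h (n + J) = h n) (a : ℕ) :
    ∑ j ∈ range J, h (a + j) = ∑ j ∈ range J, h j := by
  induction a with
  | zero => simp
  | succ a ih =>
    have h1 := sum_range_succ (fun j => h (a + j)) J
    rw [sum_range_succ', add_zero, hper, add_left_inj] at h1
    rw [← ih, ← h1]
    exact sum_congr rfl fun j _ => by rw [add_right_comm, add_assoc]

section Rotation

variable {J : ℕ} [NeZero J]

/-- The partial sums of the periodic extension of the counts of the values of `g`. -/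
def cyclicCount (g : Fin J → Fin J) (n : ℕ) : ℕ :=
  ∑ u ∈ range n, #{i | g i = Fin.ofNat J u}

theorem cyclicCount_self (g : Fin J → Fin J) : cyclicCount g J = J := by
  rw [cyclicCount, ← Fin.sum_univ_eq_sum_range fun u => #{i | g i = Fin.ofNat J u}]
  have h := card_eq_sum_card_fiberwise (f := g) (s := univ) (t := univ) fun i _ => mem_univ (g i)
  rw [card_univ, Fintype.card_fin] at h
  conv_rhs => rw [h]
  exact sum_congr rfl fun u _ => by simp

theorem cyclicCount_add_self (g : Fin J → Fin J) (n : ℕ) :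
    cyclicCount g (n + J) = cyclicCount g n + J := by
  rw [add_comm n J, cyclicCount, sum_range_add, ← cyclicCount, cyclicCount_self, add_comm]
  congr 1
  refine sum_congr rfl fun u _ => ?_
  have : Fin.ofNat J (J + u) = Fin.ofNat J u := by
    ext
    simp
  rw [this]

theorem cyclicCount_add_card (g : Fin J → Fin J) (t j : Fin J) :
    cyclicCount g t + #{i | g i - t ≤ j} = cyclicCount g (t + (j + 1)) := by
  rw [cyclicCount, cyclicCount, sum_range_add]
  congr 1
  rw [card_eq_sum_card_fiberwise (f := fun i => (g i - t).val) (t := range (j + 1))]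
  · refine sum_congr rfl fun u hu => ?_
    have huj : u < j.val + 1 := mem_range.mp hu
    have huJ : u < J := by omega
    have hof : Fin.ofNat J (t.val + u) = ⟨u, huJ⟩ + t := by
      ext
      simp [Fin.val_add, add_comm]
    congr 1
    ext i
    simp only [mem_filter, mem_univ, true_and, hof, ← sub_eq_iff_eq_add, Fin.ext_iff, Fin.le_def]
    omega
  · intro i hi
    have : g i - t ≤ j := by simpa using hi
    simpa [Nat.lt_succ_iff] using this

/-- With `h n = 2 ^ (cyclicCount g n - n)`, which is `J`-periodic, the `j`-th term of the rotated
sum is `2 h (t + j + 1) / h t`. Summing over a full period removes the dependence on `t`. -/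
theorem coincidenceSum_rotate (g : Fin J → Fin J) (t : Fin J) :
    coincidenceSum (fun i => g i - t) * (2 ^ cyclicCount g t * (1 / 2) ^ t.val) =
      2 * ∑ n ∈ range J, (2 : ℝ) ^ cyclicCount g n * (1 / 2) ^ n := by
  set h : ℕ → ℝ := fun n => 2 ^ cyclicCount g n * (1 / 2) ^ n with hh
  have hper : ∀ n, h (n + J) = h n := by
    intro n
    simp only [hh, cyclicCount_add_self, pow_add]
    have : (2 : ℝ) ^ J * (1 / 2) ^ J = 1 := by rw [← mul_pow]; norm_num
    linear_combination (2 : ℝ) ^ cyclicCount g n * (1 / 2) ^ n * this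
  rw [← sum_range_add_of_periodic hper (t.val + 1),
    ← Fin.sum_univ_eq_sum_range fun j => h (t.val + 1 + j), coincidenceSum, sum_mul, mul_sum]
  refine sum_congr rfl fun j _ => ?_
  simp only [hh]
  rw [show t.val + 1 + j.val = t.val + (j.val + 1) by ring, ← cyclicCount_add_card]
  simp only [pow_add]
  ring

theorem sum_inv_coincidenceSum_rotate (g : Fin J → Fin J) :
    ∑ t : Fin J, (coincidenceSum fun i => g i - t)⁻¹ = 1 / 2 := by
  set H := ∑ n ∈ range J, (2 : ℝ) ^ cyclicCount g n * (1 / 2) ^ n with hH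
  have hHpos : 0 < H := sum_pos (fun n _ => by positivity) ⟨0, by simp [NeZero.pos J]⟩
  have hterm : ∀ t : Fin J, (coincidenceSum fun i => g i - t)⁻¹ =
      2 ^ cyclicCount g t * (1 / 2) ^ t.val * (2 * H)⁻¹ := by
    intro t
    have h1 := coincidenceSum_rotate g t
    have h2 := coincidenceSum_pos fun i => g i - t
    rw [← hH] at h1
    rw [← h1]
    field_simp
  simp only [hterm]
  rw [← sum_mul, Fin.sum_univ_eq_sum_range fun t => (2 : ℝ) ^ cyclicCount g t * (1 / 2) ^ t, ← hH]
  field_simp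

/-- Each rotation permutes the maps `g`, so summing over all `J` rotations counts every `g` equally
often. -/
theorem sum_inv_coincidenceSum :
    ∑ g : Fin J → Fin J, (coincidenceSum g)⁻¹ = (J : ℝ) ^ J / (2 * J) := by
  have hJ : (0 : ℝ) < J := by exact_mod_cast NeZero.pos J
  have h1 : ∀ t : Fin J, ∑ g : Fin J → Fin J, (coincidenceSum fun i => g i - t)⁻¹ =
      ∑ g : Fin J → Fin J, (coincidenceSum g)⁻¹ := fun t =>
    Equiv.sum_comp (Equiv.subRight fun _ : Fin J => t) fun g => (coincidenceSum g)⁻¹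
  have h2 : (J : ℝ) * ∑ g : Fin J → Fin J, (coincidenceSum g)⁻¹ = J ^ J * (1 / 2) := by
    calc _ = ∑ t : Fin J, ∑ g : Fin J → Fin J, (coincidenceSum fun i => g i - t)⁻¹ := by
          simp [h1]
      _ = ∑ g : Fin J → Fin J, (1 / 2 : ℝ) := by
          rw [sum_comm]
          exact sum_congr rfl fun g _ => sum_inv_coincidenceSum_rotate g
      _ = _ := by simp
  rw [eq_div_iff (by positivity)]
  linarith

end Rotation

/-! ### Lower bound for the Poisson sum -/

theorem card_subsetSums_le_card_sumSet_tally {k r : ℕ} (a : Fin r → Fin k) :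
    #(subsetSums fun i => (a i).val + 1) ≤ #(sumSet (tally a)) := by
  refine card_le_card fun n hn => ?_
  obtain ⟨Y, -, rfl⟩ := mem_image.mp hn
  refine mem_image.mpr ⟨fun j => #{i ∈ Y | a i = j}, ?_, ?_⟩
  · rw [mem_Iic]
    exact fun j => card_le_card (filter_subset_filter _ (subset_univ Y))
  · rw [← sum_fiberwise Y a]
    refine sum_congr rfl fun j _ => ?_
    rw [mul_comm, ← smul_eq_mul, ← sum_const]
    exact sum_congr rfl fun i hi => by rw [(mem_filter.mp hi).2]

/-- The boxes are disjoint, since a tuple determines the blocks of its entries, and these entries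
are at most `2 ^ J - 1 ≤ k + 1`. -/
theorem sum_dyadicBox_le {k J : ℕ} (hk : 2 ^ J ≤ k + 2) :
    ∑ g : Fin J → Fin J, ∑ v ∈ dyadicBox (fun i => (g i).val),
        recipProd v * (#(subsetSums v) : ℝ) ≤
      ∑ a : Fin J → Fin (k + 1), (∏ i, 1 / (((a i).val : ℝ) + 1)) * (#(sumSet (tally a)) : ℝ) := by
  set e : (Σ _ : Fin J → Fin J, Fin J → ℕ) → Fin J → Fin (k + 1) :=
    fun p i => Fin.ofNat (k + 1) (p.2 i - 1) with he
  set S : Finset (Σ _ : Fin J → Fin J, Fin J → ℕ) :=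
    univ.sigma fun g => dyadicBox (fun i => (g i).val) with hS
  have hbox : ∀ p ∈ S, ∀ i, 2 ^ (p.1 i).val ≤ p.2 i ∧ p.2 i < 2 ^ ((p.1 i).val + 1) :=
    fun p hp i => mem_Ico.mp (Fintype.mem_piFinset.mp (mem_sigma.mp hp).2 i)
  have hval : ∀ p ∈ S, ∀ i, (e p i).val + 1 = p.2 i := by
    intro p hp i
    obtain ⟨h1, h2⟩ := hbox p hp i
    have h3 : 2 ^ ((p.1 i).val + 1) ≤ 2 ^ J := Nat.pow_le_pow_right two_pos (p.1 i).isLt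
    have h4 : 0 < p.2 i := lt_of_lt_of_le (by positivity) h1
    simp only [he, Fin.val_ofNat]
    rw [Nat.mod_eq_of_lt (by omega)]
    omega
  have hinj : Set.InjOn e S := by
    rintro ⟨g, v⟩ hp ⟨g', v'⟩ hp' heq
    have hv : v = v' := by
      funext i
      exact (hval _ hp i).symm.trans
        ((congrArg (fun a : Fin J → Fin (k + 1) => (a i).val + 1) heq).trans (hval _ hp' i))
    subst hv
    have hg : g = g' := by
      funext i
      have h1 := hbox _ hp i
      have h2 := hbox _ hp' i
      have h3 : v i ≠ 0 := (lt_of_lt_of_le (by positivity) h1.1).ne'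
      have h4 := (Nat.log_eq_iff (Or.inr ⟨one_lt_two, h3⟩)).mpr h1
      have h5 := (Nat.log_eq_iff (Or.inr ⟨one_lt_two, h3⟩)).mpr h2
      exact Fin.ext (h4.symm.trans h5)
    rw [hg]
  rw [sum_sigma']
  calc _ ≤ ∑ p ∈ S, (∏ i, 1 / (((e p i).val : ℝ) + 1)) * (#(sumSet (tally (e p))) : ℝ) := by
        refine sum_le_sum fun p hp => ?_
        have h1 : p.2 = fun i => (e p i).val + 1 := funext fun i => (hval p hp i).symm
        have h2 : recipProd p.2 = ∏ i, 1 / (((e p i).val : ℝ) + 1) := by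
          rw [recipProd]
          refine prod_congr rfl fun i _ => ?_
          rw [← hval p hp i]
          push_cast
          rfl
        rw [← h2]
        refine mul_le_mul_of_nonneg_left ?_ (recipProd_nonneg _)
        conv_lhs => rw [h1]
        exact_mod_cast card_subsetSums_le_card_sumSet_tally (e p)
    _ = ∑ a ∈ S.image e, (∏ i, 1 / (((a i).val : ℝ) + 1)) * (#(sumSet (tally a)) : ℝ) := by
        rw [sum_image hinj]
    _ ≤ _ := sum_le_sum_of_subset_of_nonneg (subset_univ _) fun a _ _ => by positivity

theorem tsum_card_sumSet_ge {k J : ℕ} [NeZero J] (hk : 2 ^ J ≤ k + 2) :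
    ENNReal.ofReal (2 ^ J * Real.log 2 ^ (J + 1) * ((J : ℝ) ^ J / (2 * J)) / J !) ≤
      ∑' c : Fin (k + 1) → ℕ, poissonWeight
        (fun j : Fin (k + 1) => ENNReal.ofReal (1 / ((j : ℕ) + 1 : ℝ))) c *
          (#(sumSet c) : ℝ≥0∞) := by
  set x : Fin (k + 1) → ℝ≥0∞ := fun j => ENNReal.ofReal (1 / ((j : ℕ) + 1 : ℝ)) with hx
  have hreal : 2 ^ J * Real.log 2 ^ (J + 1) * ((J : ℝ) ^ J / (2 * J)) ≤
      ∑ a : Fin J → Fin (k + 1), (∏ i, 1 / (((a i).val : ℝ) + 1)) * (#(sumSet (tally a)) : ℝ) := by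
    refine le_trans ?_ (sum_dyadicBox_le hk)
    rw [← sum_inv_coincidenceSum, mul_sum]
    exact sum_le_sum fun g _ => sum_recipProd_mul_card_subsetSums_ge g
  rw [← tsum_layerSum]
  refine le_trans ?_ (ENNReal.le_tsum J)
  rw [ENNReal.ofReal_div_of_pos (by positivity)]
  refine ENNReal.div_le_of_le_mul' ?_
  rw [ENNReal.ofReal_natCast, factorial_mul_layerSum]
  refine (ENNReal.ofReal_le_ofReal hreal).trans_eq ?_
  rw [ENNReal.ofReal_sum_of_nonneg fun a _ => by positivity]
  refine sum_congr rfl fun a _ => ?_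
  rw [ENNReal.ofReal_mul (by positivity), ENNReal.ofReal_natCast,
    ENNReal.ofReal_prod_of_nonneg fun i _ => by positivity]

theorem exists_le_tsum_card_sumSet : ∃ c : ℝ, 0 < c ∧ ∀ k J : ℕ, J ≠ 0 → 2 ^ J ≤ k + 2 →
    ENNReal.ofReal (c * ((2 * Real.exp 1 * Real.log 2) ^ J * (J : ℝ) ^ (-(3 / 2) : ℝ))) ≤
      ∑' c : Fin (k + 1) → ℕ, poissonWeight
        (fun j : Fin (k + 1) => ENNReal.ofReal (1 / ((j : ℕ) + 1 : ℝ))) c *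
          (#(sumSet c) : ℝ≥0∞) := by
  have hlog : 0 < Real.log 2 := Real.log_pos one_lt_two
  refine ⟨Real.log 2 / (2 * Real.exp 1), by positivity, fun k J hJ hk => ?_⟩
  have : NeZero J := ⟨hJ⟩
  have hJ0 : (0 : ℝ) < J := by exact_mod_cast Nat.pos_of_ne_zero hJ
  refine le_trans (ENNReal.ofReal_le_ofReal ?_) (tsum_card_sumSet_ge hk)
  rw [le_div_iff₀ (by positivity)]
  -- The cycle average supplies `1 / J` and Stirling's formula `J ^ (-1/2)`.
  have hpow : (J : ℝ) ^ (-(3 / 2) : ℝ) * √J = (J : ℝ)⁻¹ := by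
    rw [Real.sqrt_eq_rpow, ← Real.rpow_add hJ0, ← Real.rpow_neg_one]
    norm_num
  calc _ ≤ Real.log 2 / (2 * Real.exp 1) * ((2 * Real.exp 1 * Real.log 2) ^ J *
        (J : ℝ) ^ (-(3 / 2) : ℝ)) * (Real.exp 1 * √J * ((J : ℝ) / Real.exp 1) ^ J) := by
        gcongr
        exact factorial_le_stirling hJ
    _ = Real.log 2 / (2 * Real.exp 1) * (2 * Real.exp 1 * Real.log 2) ^ J * Real.exp 1 *
        ((J : ℝ) / Real.exp 1) ^ J * ((J : ℝ) ^ (-(3 / 2) : ℝ) * √J) := by ring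
    _ ≤ _ := by
        apply le_of_eq
        rw [hpow]
        simp only [mul_pow, div_pow, pow_succ]
        field_simp

/-! ### From Poisson sums to the expectation -/

theorem lintegral_comp_poisson {ι Ω : Type*} [Fintype ι] [MeasurableSpace Ω] {μ : Measure Ω}
    [IsProbabilityMeasure μ] {X : ι → Ω → ℕ} (hX : iIndepFun X μ) (r : ι → ℝ≥0)
    (hlaw : ∀ j, HasLaw (X j) (poissonMeasure (r j)) μ) (G : (ι → ℕ) → ℝ≥0∞) :
    ∫⁻ ω, G (fun j => X j ω) ∂μ = ENNReal.ofReal (Real.exp (-∑ j, (r j : ℝ))) *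
      ∑' c, poissonWeight (fun j => ENNReal.ofReal (r j)) c * G c := by
  have hae : ∀ j, AEMeasurable (X j) μ := fun j => (hlaw j).aemeasurable
  have hmap : μ.map (fun ω j => X j ω) = Measure.pi fun j => poissonMeasure (r j) := by
    rw [(iIndepFun_iff_map_fun_eq_pi_map hae).mp hX]
    simp only [(hlaw _).map_eq]
  rw [← lintegral_map' (f := G) (measurable_of_countable G).aemeasurable
    (aemeasurable_pi_lambda _ hae), hmap, lintegral_countable', ← ENNReal.tsum_mul_left]
  refine tsum_congr fun c => ?_
  have hsingle : (Measure.pi fun j => poissonMeasure (r j)) {c} =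
      ENNReal.ofReal (Real.exp (-∑ j, (r j : ℝ))) *
        poissonWeight (fun j => ENNReal.ofReal (r j)) c := by
    rw [Measure.pi_singleton, ← sum_neg_distrib, Real.exp_sum,
      ENNReal.ofReal_prod_of_nonneg fun _ _ => (Real.exp_pos _).le, poissonWeight,
      ← prod_mul_distrib]
    refine prod_congr rfl fun j _ => ?_
    rw [poissonMeasure_singleton, mul_div_assoc, ENNReal.ofReal_mul (Real.exp_pos _).le,
      ENNReal.ofReal_div_of_pos (by positivity), ENNReal.ofReal_pow (by positivity),
      ENNReal.ofReal_natCast]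
  rw [hsingle, mul_comm, mul_assoc]

theorem one_sub_delta_mul_log_two : (1 - delta) * Real.log 2 = 1 + Real.log (Real.log 2) := by
  have : Real.log 2 ≠ 0 := (Real.log_pos one_lt_two).ne'
  rw [delta]
  field_simp
  ring

theorem one_sub_delta_pos : 0 < 1 - delta := by
  have hlog : 0 < Real.log 2 := Real.log_pos one_lt_two
  have h1 : 0 < Real.log (Real.exp 1 * Real.log 2) := by
    refine Real.log_pos ?_
    have h2 := Real.exp_one_gt_d9
    have h3 := Real.log_two_gt_d9
    nlinarith
  rw [Real.log_mul (Real.exp_pos 1).ne' hlog.ne', Real.log_exp, ← one_sub_delta_mul_log_two] at h1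
  exact pos_of_mul_pos_left h1 hlog.le

/-- This is the source of `δ`: `e log 2 = 2 ^ (1 - δ)`. -/
theorem exp_one_mul_log_two_pow (J : ℕ) :
    (Real.exp 1 * Real.log 2) ^ J = ((2 : ℝ) ^ J) ^ (1 - delta) := by
  have hlog : 0 < Real.log 2 := Real.log_pos one_lt_two
  have h : Real.exp 1 * Real.log 2 = (2 : ℝ) ^ (1 - delta) := by
    rw [Real.rpow_def_of_pos two_pos, mul_comm (Real.log 2), one_sub_delta_mul_log_two,
      Real.exp_add, Real.exp_log hlog]
  rw [h, Real.rpow_pow_comm zero_le_two]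

theorem sum_fin_one_div (k : ℕ) : ∑ j : Fin k, 1 / ((j : ℕ) + 1 : ℝ) = (harmonic k : ℝ) := by
  rw [harmonic, Fin.sum_univ_eq_sum_range fun j => 1 / ((j : ℝ) + 1)]
  push_cast
  simp

theorem exp_neg_harmonic_le {k : ℕ} (hk : k ≠ 0) : Real.exp (-(harmonic k : ℝ)) ≤ 1 / k := by
  have hk0 : (0 : ℝ) < k := by exact_mod_cast Nat.pos_of_ne_zero hk
  have h := log_add_one_le_harmonic k
  have h1 : Real.log k ≤ harmonic k :=
    (Real.log_le_log hk0 (by push_cast; linarith)).trans h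
  rw [Real.exp_neg, ← one_div]
  gcongr
  exact (Real.log_le_iff_le_exp hk0).mp h1

theorem le_exp_neg_harmonic {k : ℕ} (hk : k ≠ 0) :
    Real.exp (-1) / k ≤ Real.exp (-(harmonic k : ℝ)) := by
  have hk0 : (0 : ℝ) < k := by exact_mod_cast Nat.pos_of_ne_zero hk
  have h := harmonic_le_one_add_log k
  calc Real.exp (-1) / k = Real.exp (-(1 + Real.log k)) := by
        rw [neg_add, Real.exp_add, Real.exp_neg (Real.log k), Real.exp_log hk0, div_eq_mul_inv]
    _ ≤ _ := by gcongr

theorem exists_upper_bound {C : ℝ} (hC : 0 < C) : ∃ C' : ℝ, 0 < C' ∧ ∀ k : ℕ,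
    Real.exp (-(harmonic (k + 1) : ℝ)) * (C * ((2 * Real.exp 1 * Real.log 2) ^ (Nat.log 2 k + 1) *
      (((Nat.log 2 k + 1 : ℕ) : ℝ) + 1) ^ (-(3 / 2) : ℝ))) ≤
    C' * (((k + 1 : ℕ) : ℝ) ^ (1 - delta) *
      (1 + Real.log ((k + 1 : ℕ) : ℝ)) ^ (-(3 / 2) : ℝ)) := by
  have hlog : 0 < Real.log 2 := Real.log_pos one_lt_two
  have hlog1 : Real.log 2 ≤ 1 := by have := Real.log_two_lt_d9; linarith
  refine ⟨2 * C * 2 ^ (1 - delta), by positivity, fun k => ?_⟩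
  set J := Nat.log 2 k + 1 with hJ
  set K : ℝ := ((k + 1 : ℕ) : ℝ) with hK
  have hK1 : 1 ≤ K := by rw [hK]; exact_mod_cast Nat.le_add_left 1 k
  have hK0 : 0 < K := by linarith
  have hup : (2 : ℝ) ^ J ≤ 2 * K := by
    have : 2 ^ J ≤ 2 * (k + 1) := by
      rw [hJ, pow_succ, mul_comm]
      refine Nat.mul_le_mul_left 2 ?_
      rcases Nat.eq_zero_or_pos k with rfl | hk
      · simp
      · exact (Nat.pow_log_le_self 2 hk.ne').trans (Nat.le_succ k)
    rw [hK]
    exact_mod_cast this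
  have hlow : K ≤ (2 : ℝ) ^ J := by
    have : k + 1 ≤ 2 ^ J := Nat.lt_pow_succ_log_self one_lt_two k
    rw [hK]
    exact_mod_cast this
  have hlogK : Real.log K ≤ J := by
    have h := Real.log_le_log hK0 hlow
    rw [Real.log_pow] at h
    have : (0 : ℝ) ≤ J := Nat.cast_nonneg J
    nlinarith
  have hlogK0 := Real.log_nonneg hK1
  have h1 : ((J : ℝ) + 1) ^ (-(3 / 2) : ℝ) ≤ (1 + Real.log K) ^ (-(3 / 2) : ℝ) :=
    Real.rpow_le_rpow_of_nonpos (by positivity) (by linarith) (by norm_num)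
  have h2 : (2 * Real.exp 1 * Real.log 2) ^ J ≤ 2 * K * (2 * K) ^ (1 - delta) := by
    rw [mul_assoc, mul_pow, exp_one_mul_log_two_pow]
    gcongr
    exact one_sub_delta_pos.le
  calc _ ≤ 1 / K * (C * (2 * K * (2 * K) ^ (1 - delta) *
        (1 + Real.log K) ^ (-(3 / 2) : ℝ))) := by
        gcongr
        exact exp_neg_harmonic_le k.succ_ne_zero
    _ = _ := by
        rw [Real.mul_rpow zero_le_two hK0.le]
        field_simp

theorem exists_lower_bound {c : ℝ} (hc : 0 < c) : ∃ c' : ℝ, 0 < c' ∧ ∀ k : ℕ,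
    c' * (((k + 1 : ℕ) : ℝ) ^ (1 - delta) *
      (1 + Real.log ((k + 1 : ℕ) : ℝ)) ^ (-(3 / 2) : ℝ)) ≤
    Real.exp (-(harmonic (k + 1) : ℝ)) * (c * ((2 * Real.exp 1 * Real.log 2) ^ (Nat.log 2 (k + 2)) *
      ((Nat.log 2 (k + 2) : ℕ) : ℝ) ^ (-(3 / 2) : ℝ))) := by
  have hlog : 1 / 2 ≤ Real.log 2 := by have := Real.log_two_gt_d9; linarith
  refine ⟨Real.exp (-1) * c * (1 / 2) * (1 / 2) ^ (1 - delta) * 2 ^ (-(3 / 2) : ℝ),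
    by positivity, fun k => ?_⟩
  -- The largest `J` with `2 ^ J ≤ k + 2`; there are `k + 1` variables, so `J ≥ 1` always.
  set J := Nat.log 2 (k + 2) with hJ
  set K : ℝ := ((k + 1 : ℕ) : ℝ) with hK
  have hK1 : 1 ≤ K := by rw [hK]; exact_mod_cast Nat.le_add_left 1 k
  have hK0 : 0 < K := by linarith
  have hJ1 : 1 ≤ J := Nat.le_log_of_pow_le one_lt_two (by omega)
  have hJ0 : (0 : ℝ) < J := by exact_mod_cast hJ1
  have hup : (2 : ℝ) ^ J ≤ 2 * K := by
    have h1 : 2 ^ J ≤ k + 2 := Nat.pow_log_le_self 2 (by omega)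
    have h2 : 2 ^ J ≤ 2 * (k + 1) := by omega
    rw [hK]
    exact_mod_cast h2
  have hlow : 1 / 2 * K ≤ (2 : ℝ) ^ J := by
    have h1 : k + 2 < 2 ^ (J + 1) := Nat.lt_pow_succ_log_self one_lt_two _
    have h2 : k + 1 ≤ 2 * 2 ^ J := by rw [pow_succ] at h1; omega
    have h3 : K ≤ 2 * 2 ^ J := by rw [hK]; exact_mod_cast h2
    linarith
  have hlogK0 := Real.log_nonneg hK1
  have hlogJ : (J : ℝ) ≤ 2 * (1 + Real.log K) := by
    have h := Real.log_le_log (by positivity) hup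
    rw [Real.log_pow, Real.log_mul two_ne_zero hK0.ne'] at h
    nlinarith
  have h1 : (2 * (1 + Real.log K)) ^ (-(3 / 2) : ℝ) ≤ (J : ℝ) ^ (-(3 / 2) : ℝ) :=
    Real.rpow_le_rpow_of_nonpos hJ0 hlogJ (by norm_num)
  have h2 : 1 / 2 * K * (1 / 2 * K) ^ (1 - delta) ≤ (2 * Real.exp 1 * Real.log 2) ^ J := by
    rw [mul_assoc 2, mul_pow, exp_one_mul_log_two_pow]
    gcongr
    exact one_sub_delta_pos.le
  calc _ = Real.exp (-1) / K * (c * (1 / 2 * K * (1 / 2 * K) ^ (1 - delta) *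
        (2 * (1 + Real.log K)) ^ (-(3 / 2) : ℝ))) := by
        rw [Real.mul_rpow (by norm_num) hK0.le, Real.mul_rpow zero_le_two (by positivity)]
        field_simp
    _ ≤ _ := by
        gcongr
        exact le_exp_neg_harmonic k.succ_ne_zero

theorem exists_lintegral_card_sumSet_bounds : ∃ c C : ℝ, 0 < c ∧ 0 < C ∧
    ∀ k : ℕ, 1 ≤ k → ∀ (Ω : Type*) [MeasurableSpace Ω] (μ : Measure Ω) [IsProbabilityMeasure μ]
      (X : Fin k → Ω → ℕ), iIndepFun X μ →
      (∀ j : Fin k, HasLaw (X j) (poissonMeasure (1 / ((j : ℕ) + 1))) μ) →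
      ENNReal.ofReal (c * ((k : ℝ) ^ (1 - delta) * (1 + Real.log k) ^ (-(3 / 2) : ℝ))) ≤
        ∫⁻ ω, (#(sumSet fun j => X j ω) : ℝ≥0∞) ∂μ ∧
      ∫⁻ ω, (#(sumSet fun j => X j ω) : ℝ≥0∞) ∂μ ≤
        ENNReal.ofReal (C * ((k : ℝ) ^ (1 - delta) * (1 + Real.log k) ^ (-(3 / 2) : ℝ))) := by
  obtain ⟨c₀, hc₀, hlow⟩ := exists_le_tsum_card_sumSet
  obtain ⟨C₀, hC₀, hup⟩ := exists_tsum_card_sumSet_le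
  obtain ⟨c, hc, hlow'⟩ := exists_lower_bound hc₀
  obtain ⟨C, hC, hup'⟩ := exists_upper_bound hC₀
  refine ⟨c, C, hc, hC, fun k hk Ω _ μ _ X hX hlaw => ?_⟩
  obtain ⟨k, rfl⟩ := Nat.exists_eq_add_of_le' hk
  have hr : ∀ j : Fin (k + 1), (((1 / ((j : ℕ) + 1) : ℝ≥0)) : ℝ) = 1 / ((j : ℕ) + 1 : ℝ) :=
    fun j => by push_cast; rfl
  rw [lintegral_comp_poisson hX _ hlaw fun c => (#(sumSet c) : ℝ≥0∞)]
  simp only [hr]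
  rw [sum_fin_one_div]
  constructor
  · refine (ENNReal.ofReal_le_ofReal (hlow' k)).trans ?_
    rw [ENNReal.ofReal_mul (Real.exp_pos _).le]
    gcongr
    exact hlow k _ (Nat.log_pos one_lt_two (by omega)).ne'
      (Nat.pow_log_le_self 2 (by omega))
  · refine le_trans ?_ (ENNReal.ofReal_le_ofReal (hup' k))
    rw [ENNReal.ofReal_mul (Real.exp_pos _).le]
    gcongr
    exact hup k

end FixedSets


theorem proposition4 :
    ∃ c C : ℝ, 0 < c ∧ 0 < C ∧
      ∀ k : ℕ, 1 ≤ k →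
      ∀ (Ω : Type*) [MeasurableSpace Ω] (μ : Measure Ω) [IsProbabilityMeasure μ]
        (X : Fin k → Ω → ℕ),
        iIndepFun X μ →
        (∀ j : Fin k, HasLaw (X j) (poissonMeasure (1 / ((j : ℕ) + 1))) μ) →
        Integrable (fun ω => ((FixedSets.sumSet fun j => X j ω).card : ℝ)) μ ∧
        c * ((k : ℝ) ^ (1 - FixedSets.delta) * (1 + Real.log k) ^ (-(3 / 2) : ℝ)) ≤
          ∫ ω, ((FixedSets.sumSet fun j => X j ω).card : ℝ) ∂μ ∧
        ∫ ω, ((FixedSets.sumSet fun j => X j ω).card : ℝ) ∂μ ≤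
          C * ((k : ℝ) ^ (1 - FixedSets.delta) * (1 + Real.log k) ^ (-(3 / 2) : ℝ)) := by
  obtain ⟨c, C, hc, hC, h⟩ := FixedSets.exists_lintegral_card_sumSet_bounds
  refine ⟨c, C, hc, hC, fun k hk Ω _ μ _ X hX hlaw => ?_⟩
  obtain ⟨hlow, hup⟩ := h k hk Ω μ X hX hlaw
  have hpos : 0 ≤ C * ((k : ℝ) ^ (1 - FixedSets.delta) * (1 + Real.log k) ^ (-(3 / 2) : ℝ)) := by
    have := Real.log_natCast_nonneg k
    positivity
  have hmeas : AEStronglyMeasurable (fun ω => ((FixedSets.sumSet fun j => X j ω).card : ℝ)) μ :=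
    ((measurable_of_countable fun m : Fin k → ℕ =>
      ((FixedSets.sumSet m).card : ℝ)).comp_aemeasurable
        (aemeasurable_pi_lambda _ fun j => (hlaw j).aemeasurable)).aestronglyMeasurable
  have hint : Integrable (fun ω => ((FixedSets.sumSet fun j => X j ω).card : ℝ)) μ := by
    refine ⟨hmeas, ?_⟩
    rw [hasFiniteIntegral_iff_norm]
    simp only [Real.norm_natCast, ENNReal.ofReal_natCast]
    exact hup.trans_lt ENNReal.ofReal_lt_top
  have heq : ENNReal.ofReal (∫ ω, ((FixedSets.sumSet fun j => X j ω).card : ℝ) ∂μ) =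
      ∫⁻ ω, ((FixedSets.sumSet fun j => X j ω).card : ENNReal) ∂μ := by
    rw [ofReal_integral_eq_lintegral_ofReal hint (ae_of_all _ fun ω => Nat.cast_nonneg _)]
    simp only [ENNReal.ofReal_natCast]
  rw [← heq] at hlow hup
  exact ⟨hint, (ENNReal.ofReal_le_ofReal_iff (integral_nonneg fun ω => Nat.cast_nonneg _)).mp hlow,
    (ENNReal.ofReal_le_ofReal_iff hpos).mp hup⟩
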